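/- **Setting.** Let $d\ge 1$, let $\Theta\subset\mathbb R^d$ be compact, and for each $\theta\in\Theta$ let $\nu_\theta$ be a Borel probability measure on the set of probability vectors $w=(w(-2),w(-1),w(1))$ on the three jumps $-2,-1,1$. Let $\mathbb P^\theta=\nu_\theta^{\otimes\mathbb Z}$ be the law of an i.i.d. environment $\omega=(\omega_x)_{x\in\mathbb Z}$, with expectation $\mathbb E^\theta$. Put $a_k=\omega_k(-1)/\omega_k(1)$, $b_k=\omega_k(-2)/\omega_k(1)$, $$A_k=\begin{pmatrix}a_k&b_k&0\\a_k&b_k&1\\a_k&b_k&0\end{pmatrix},\qquad \pi(\omega)=1+\sum_{k\ge1}\mathbf e_1A_k\cdots A_1(2,1,2)^t .$$ Let $\theta^*\in\Theta$ (the true parameter) be an interior point of $\Theta$. Assume: * (C1) $\inf_{\theta\in\Theta}\mathbb E^\theta[\log\omega_0(l)]>-\infty$ for $l=-2,-1,1$ (with $\log 0=-\infty$); * (C2) for every $\theta\in\Theta$, the top Lyapunov exponent of $(A_k)$ under $\mathbb P^\theta$, i.e. the almost sure limit of $\frac1n\log\|A_0A_1\cdots A_{n-1}\|$, is negative; * (C3)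 $\mathbb E^\theta[\pi(\omega)]<\infty$ for every $\theta\in\Theta$; * (C4) $\theta\mapsto\nu_\theta$ is continuous on $\Theta$ for the weak topology; * (C5) for all $\theta,\theta'\in\Theta$: $\nu_\theta\ne\nu_{\theta'}$ if and only if $\theta\ne\theta'$. **The branching chain.** For a probability vector $w$, let an individual of type $1$ or $3$ have offspring $(a,b,0)$, and an individual of type $2$ have offspring $(a,b,1)$, with probability $\frac{(a+b)!}{a!\,b!}w(-1)^aw(-2)^bw(1)$, $a,b\in\mathbb N=\{0,1,2,\dots\}$. For $\mathbf x\in\mathbb N^3$ let $Q_{\theta}(\mathbf x,\cdot)$ be the $\nu_{\theta}(dw)$-average of the law of the total offspring of $1+x_1$ individuals of type $1$, $x_2$ of type $2$ and $x_3$ of type $3$, all reproducing independently given $w$. So $Q_\theta$ is the annealed transition kernel of the 3-type branching process in random environment with one immigrant of type $1$ per generation. For $\theta\in\Theta$ and $\mathbf z,\mathbf z'\in\mathbb N^3$ put $$\tilde\phi_\theta(\mathbf z,\mathbf z')=\log\int w(-1)^{z'_1}\,w(-2)^{z'_2}\,w(1)^{z_1+z_2+z_3+1}\,\nu_\theta(dw).$$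 **Theorem.** Assume (C1)–(C5). Then the kernel $Q_{\theta^*}$ has a unique invariant probability measure $\pi_{\theta^*}$ on $\mathbb N^3$. Let $(\widetilde{\mathbf Z}_0,\widetilde{\mathbf Z}_1)$ be the first two states of the chain with kernel $Q_{\theta^*}$ and initial law $\pi_{\theta^*}$, and write $\mathbf E^*$ for its expectation. For every $\theta\in\Theta$ the limit contrast $$l(\theta)=\mathbf E^*\big[\tilde\phi_\theta(\widetilde{\mathbf Z}_0,\widetilde{\mathbf Z}_1)\big]$$ is well defined and finite, and for every $\varepsilon>0$ $$\sup_{\theta\in\Theta:\ \|\theta-\theta^*\|\ge\varepsilon}l(\theta)<l(\theta^*)$$ (Euclidean norm; the supremum of the empty set is $-\infty$). In particular $l(\theta)<l(\theta^*)$ for every $\theta\in\Theta$ with $\theta\ne\theta^*$, so $\theta^*$ is the unique, well-separated maximiser of $l$. -/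

import Mathlib

open MeasureTheory ProbabilityTheory Filter Topology

namespace RWRE

/-- Jump law at one site: a probability vector on the jumps `-2, -1, 1`, stored in this order.
The topology (and Borel structure) of the simplex is that of weak convergence. -/
abbrev SiteLaw : Type := stdSimplex ℝ (Fin 3)

/-- `ω_x(-2)` -/
def left2 (w : SiteLaw) : ℝ := w.1 0

/-- `ω_x(-1)` -/
def left1 (w : SiteLaw) : ℝ := w.1 1

/-- `ω_x(1)` -/
def right1 (w : SiteLaw) : ℝ := w.1 2

/-- An environment on `ℤ`. -/
abbrev Env : Type := ℤ → SiteLaw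

/-- Law of the i.i.d. environment with one-site marginal `ν`. -/
noncomputable def envLaw (ν : ProbabilityMeasure SiteLaw) : Measure Env :=
  Measure.infinitePi fun _ : ℤ => (ν : Measure SiteLaw)

/-- The matrix `A_k`, a function of the jump law at site `k`. -/
noncomputable def matA (w : SiteLaw) : Matrix (Fin 3) (Fin 3) ℝ :=
  !![left1 w / right1 w, left2 w / right1 w, 0;
     left1 w / right1 w, left2 w / right1 w, 1;
     left1 w / right1 w, left2 w / right1 w, 0]

/-- `A_0 A_1 ⋯ A_{n-1}` -/
noncomputable def prodUp (ω : Env) : ℕ → Matrix (Fin 3) (Fin 3) ℝ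
  | 0 => 1
  | n + 1 => prodUp ω n * matA (ω n)

/-- `A_k A_{k-1} ⋯ A_1` -/
noncomputable def prodDown (ω : Env) : ℕ → Matrix (Fin 3) (Fin 3) ℝ
  | 0 => 1
  | k + 1 => matA (ω ((k : ℤ) + 1)) * prodDown ω k

/-- `γ` is the top Lyapunov exponent of `A_0, A_1, …` under `envLaw ν`: almost surely
`n⁻¹ log ‖A_0 ⋯ A_{n-1}‖ → γ`, where `‖M‖ = ∑ |M i j|` (the choice of norm is immaterial). -/
def IsTopLyapunovExponent (ν : ProbabilityMeasure SiteLaw) (γ : ℝ) : Prop :=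
  ∀ᵐ ω ∂(envLaw ν),
    Tendsto (fun n : ℕ => (n : ℝ)⁻¹ * Real.log (∑ i, ∑ j, |prodUp ω n i j|)) atTop (𝓝 γ)

/-- `π(ω) = 1 + ∑_{k ≥ 1} e₁ A_k ⋯ A_1 (2,1,2)ᵗ`, with values in `[0,∞]`. -/
noncomputable def hittingSeries (ω : Env) : ENNReal :=
  1 + ∑' k : ℕ, ENNReal.ofReal ((prodDown ω (k + 1)).mulVec ![2, 1, 2] 0)

section Conditions

variable {d : ℕ} {Θ : Set (EuclideanSpace ℝ (Fin d))}

/-- `inf_θ E^θ log ω_0(l) > -∞` for the three jumps `l`. As `log 0 = 0` here, the usual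
convention `log 0 = -∞` is made explicit by the almost sure positivity. -/
def LogMoment (ν : Θ → ProbabilityMeasure SiteLaw) : Prop :=
  ∀ p ∈ ({left2, left1, right1} : Set (SiteLaw → ℝ)), ∃ C : ℝ, ∀ θ : Θ,
    (∀ᵐ w ∂(ν θ : Measure SiteLaw), 0 < p w) ∧
      Integrable (fun w => Real.log (p w)) (ν θ : Measure SiteLaw) ∧
        C ≤ ∫ w, Real.log (p w) ∂(ν θ : Measure SiteLaw)

/-- The top Lyapunov exponent is negative, i.e. the walk is transient to `+∞`. -/
def NegativeLyapunov (ν : Θ → ProbabilityMeasure SiteLaw) : Prop :=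
  ∀ θ : Θ, ∃ γ : ℝ, IsTopLyapunovExponent (ν θ) γ ∧ γ < 0

/-- `E^θ π(ω) < ∞` for all `θ`. -/
def Ballistic (ν : Θ → ProbabilityMeasure SiteLaw) : Prop :=
  ∀ θ : Θ, ∫⁻ ω, hittingSeries ω ∂(envLaw (ν θ)) < ⊤

/-- Distinct parameters are exactly those with distinct site distributions. -/
def Identifiable (ν : Θ → ProbabilityMeasure SiteLaw) : Prop :=
  ∀ θ θ' : Θ, ν θ ≠ ν θ' ↔ θ ≠ θ'

end Conditions

/-- Population vectors of the 3-type branching process. -/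
abbrev Pop : Type := Fin 3 → ℕ

/-- Offspring law of an individual whose offspring always include `c` individuals of
type 3: it gives mass `(a+b)!/(a! b!) ω(-1)^a ω(-2)^b ω(1)` to `(a,b,c)`. -/
noncomputable def offspringWith (w : SiteLaw) (c : ℕ) : Measure Pop :=
  Measure.sum fun ab : ℕ × ℕ =>
    ENNReal.ofReal ((ab.1 + ab.2).choose ab.1 * left1 w ^ ab.1 * left2 w ^ ab.2 * right1 w) •
      Measure.dirac (![ab.1, ab.2, c] : Pop)

/-- Offspring law by type: a type 2 parent (index `1`) has exactly one child of type 3, parents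
of types 1 and 3 have none. -/
noncomputable def offspring (w : SiteLaw) (i : Fin 3) : Measure Pop :=
  offspringWith w (if i = 1 then 1 else 0)

/-- Law of the sum of `n` independent random vectors with law `μ`. -/
noncomputable def convPow (μ : Measure Pop) : ℕ → Measure Pop
  | 0 => Measure.dirac 0
  | n + 1 => (convPow μ n).conv μ

/-- Quenched law of the next generation given the present one `x`, after one individual of
type 1 has immigrated. -/
noncomputable def quenchedStep (w : SiteLaw) (x : Pop) : Measure Pop :=
  ((convPow (offspring w 0) (1 + x 0)).conv (convPow (offspring w 1) (x 1))).conv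
    (convPow (offspring w 2) (x 2))

/-- Annealed transition kernel: `Q(x,{y})` is the `ν`-mean of the quenched probability. -/
noncomputable def transition (ν : ProbabilityMeasure SiteLaw) : Kernel Pop Pop :=
  Kernel.ofFunOfCountable fun x =>
    Measure.sum fun y : Pop =>
      (∫⁻ w, quenchedStep w x {y} ∂(ν : Measure SiteLaw)) • Measure.dirac y

/-- The function `φ̃_θ(z₁,z₂)`, for `ν = ν_θ`. -/
noncomputable def logWeight (ν : ProbabilityMeasure SiteLaw) (z : Pop × Pop) : ℝ :=
  Real.log (∫ w, left1 w ^ z.2 0 * left2 w ^ z.2 1 * right1 w ^ (z.1 0 + z.1 1 + z.1 2 + 1)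
    ∂(ν : Measure SiteLaw))

/-- Law of `(Z̃₀, Z̃₁)` for the chain with kernel `transition ν` and initial law `π`. -/
noncomputable def pairLaw (ν : ProbabilityMeasure SiteLaw) (π : Measure Pop) :
    Measure (Pop × Pop) :=
  π.compProd (transition ν)

/-- The limit contrast `E^*[φ̃_θ(Z̃₀, Z̃₁)]`, for `νstar = ν_{θ*}` and `ν = ν_θ`. -/
noncomputable def contrast (νstar : ProbabilityMeasure SiteLaw) (π : Measure Pop)
    (ν : ProbabilityMeasure SiteLaw) : ℝ :=
  ∫ z, logWeight ν z ∂(pairLaw νstar π)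

end RWRE

/-!
The multinomial coefficients in `Q_θ(z, z')` do not depend on `θ`, so `Q_θ(z, ·)` has density
`exp φ̃_θ(z, ·)` with respect to a fixed measure. Hence `exp (φ̃_θ - φ̃_{θ*})` has mean one under
the stationary pair law of `θ*`, and `l(θ) ≤ l(θ*)` by Jensen's inequality. Equality forces
`φ̃_θ = φ̃_{θ*}` on the charged states, which include all `(0, (i, j, 0))`: the measures
`w(1) ν_θ(dw)` and `w(1) ν_{θ*}(dw)` then have the same moments in `(w(-1), w(-2))`, so
`ν_θ = ν_{θ*}`.

The terms of `E π(ω)` satisfy a linear recursion whose summability means `E[a_0 + 2 b_0] < 1`. This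
is a Foster drift condition for the weight `x_1 + 2 x_2 + x_3`; with the Krylov–Bogolyubov theorem
it gives an invariant law with finite mean weight, unique because `0` is accessible. Since
`|φ̃_θ(z, z')|` is at most linear in the weights of `z` and `z'`, uniformly in `θ`, the contrast is
finite and continuous, and compactness upgrades the strict inequality to well-separation.
-/

namespace RWRE

/-! ### Invariant probability measures of Markov kernels -/

section InvariantMeasure

variable {α : Type*} [MeasurableSpace α] {Q : Kernel α α}

theorem comp_apply_univ (Q : Kernel α α) [IsMarkovKernel Q] (μ : Measure α) :
    (Q ∘ₘ μ) Set.univ = μ Set.univ := by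
  simp [Measure.bind_apply MeasurableSet.univ Q.aemeasurable]

theorem comp_mono (Q : Kernel α α) {μ μ' : Measure α} (h : μ ≤ μ') : Q ∘ₘ μ ≤ Q ∘ₘ μ' :=
  Measure.le_iff.2 fun s hs => by
    simpa only [Measure.bind_apply hs Q.aemeasurable] using lintegral_mono' h le_rfl

theorem invariant_of_le_comp [IsMarkovKernel Q] {μ : Measure α} [IsFiniteMeasure μ]
    (h : μ ≤ Q ∘ₘ μ) : Q.Invariant μ :=
  (Measure.eq_of_le_of_measure_univ_eq h (comp_apply_univ Q μ).symm).symm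

theorem invariant_sub [IsMarkovKernel Q] {μ μ' : Measure α} [IsFiniteMeasure μ]
    [IsFiniteMeasure μ'] (hμ : Q.Invariant μ) (hμ' : Q.Invariant μ') : Q.Invariant (μ - μ') := by
  refine invariant_of_le_comp (Measure.sub_le_of_le_add ?_)
  calc μ = Q ∘ₘ μ := hμ.def.symm
    _ ≤ Q ∘ₘ (μ - μ' + μ') := comp_mono Q (Measure.sub_le_iff_le_add.1 le_rfl)
    _ = Q ∘ₘ (μ - μ') + μ' := by rw [Measure.comp_add, hμ'.def]

/-- The state `o` can be reached from every state along transitions of positive probability. -/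
def IsAccessible (Q : Kernel α α) (o : α) : Prop :=
  ∀ x, Relation.ReflTransGen (fun x y => Q x {y} ≠ 0) x o

section Countable

variable [Countable α] [MeasurableSingletonClass α] {o : α}

theorem eq_zero_of_invariant_of_singleton_eq_zero (ho : IsAccessible Q o) {μ : Measure α}
    (hμ : Q.Invariant μ) (h0 : μ {o} = 0) : μ = 0 := by
  refine Measure.ext_of_singleton fun x => ?_
  induction ho x using Relation.ReflTransGen.head_induction_on with
  | refl => exact h0
  | head hxy _ ih =>
    rw [← hμ.def, Measure.bind_apply (measurableSet_singleton _) Q.aemeasurable,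
      lintegral_countable'] at ih
    exact (mul_eq_zero.1 (ENNReal.tsum_eq_zero.1 ih _)).resolve_left hxy

theorem invariant_unique [IsMarkovKernel Q] (ho : IsAccessible Q o) {π π' : Measure α}
    [IsProbabilityMeasure π] [IsProbabilityMeasure π'] (hπ : Q.Invariant π)
    (hπ' : Q.Invariant π') : π = π' := by
  have le_of_singleton_le : ∀ {μ μ' : Measure α} [IsFiniteMeasure μ] [IsFiniteMeasure μ'],
      Q.Invariant μ → Q.Invariant μ' → μ {o} ≤ μ' {o} → μ ≤ μ' := by
    intro μ μ' _ _ hμ hμ' h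
    have hsub : (μ - μ') {o} = 0 :=
      Measure.sub_apply_eq_zero_of_restrict_le_restrict
        (by rw [Measure.restrict_singleton, Measure.restrict_singleton]; gcongr)
        (measurableSet_singleton o)
    have hzero := eq_zero_of_invariant_of_singleton_eq_zero ho (invariant_sub hμ hμ') hsub
    simpa [hzero] using Measure.sub_le_iff_le_add (μ := μ) (ν := μ').1 le_rfl
  rcases le_total (π {o}) (π' {o}) with h | h
  · exact Measure.eq_of_le_of_isProbabilityMeasure (le_of_singleton_le hπ hπ' h)
  · exact (Measure.eq_of_le_of_isProbabilityMeasure (le_of_singleton_le hπ' hπ h)).symm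

end Countable

instance isProbabilityMeasure_iterate_comp [IsMarkovKernel Q] (μ : Measure α)
    [IsProbabilityMeasure μ] (n : ℕ) : IsProbabilityMeasure ((Q ∘ₘ ·)^[n] μ) := by
  induction n with
  | zero => assumption
  | succ n ih =>
    rw [Function.iterate_succ_apply']
    infer_instance

/-- The Cesàro average of the laws of the first `N + 1` states of the chain with kernel `Q` and
initial law `μ`. -/
noncomputable def cesaroLaw (Q : Kernel α α) (μ : Measure α) (N : ℕ) : Measure α :=
  ((N : ENNReal) + 1)⁻¹ • ∑ n ∈ Finset.range (N + 1), (Q ∘ₘ ·)^[n] μ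

theorem lintegral_cesaroLaw (Q : Kernel α α) (μ : Measure α) (N : ℕ) (f : α → ENNReal) :
    ∫⁻ x, f x ∂(cesaroLaw Q μ N)
      = ((N : ENNReal) + 1)⁻¹ * ∑ n ∈ Finset.range (N + 1), ∫⁻ x, f x ∂((Q ∘ₘ ·)^[n] μ) := by
  rw [cesaroLaw, lintegral_smul_measure, lintegral_finsetSum_measure, smul_eq_mul]

theorem inv_add_one_mul_sum_range_const (N : ℕ) (D : ENNReal) :
    ((N : ENNReal) + 1)⁻¹ * ∑ _n ∈ Finset.range (N + 1), D = D := by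
  rw [Finset.sum_const, Finset.card_range, nsmul_eq_mul, Nat.cast_add_one, ← mul_assoc,
    ENNReal.inv_mul_cancel (by simp) (by simp), one_mul]

theorem lintegral_cesaroLaw_le {μ : Measure α} {f : α → ENNReal} {D : ENNReal}
    (h : ∀ n, ∫⁻ x, f x ∂((Q ∘ₘ ·)^[n] μ) ≤ D) (N : ℕ) :
    ∫⁻ x, f x ∂(cesaroLaw Q μ N) ≤ D := by
  rw [lintegral_cesaroLaw, ← inv_add_one_mul_sum_range_const N D]
  gcongr
  exact h _

instance isProbabilityMeasure_cesaroLaw [IsMarkovKernel Q] (μ : Measure α)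
    [IsProbabilityMeasure μ] (N : ℕ) : IsProbabilityMeasure (cesaroLaw Q μ N) := by
  constructor
  rw [← lintegral_one, lintegral_cesaroLaw]
  simp only [lintegral_one, measure_univ, inv_add_one_mul_sum_range_const]

theorem lintegral_comp_cesaroLaw_add (μ : Measure α) (N : ℕ) {f : α → ENNReal}
    (hf : Measurable f) :
    ∫⁻ x, f x ∂(Q ∘ₘ cesaroLaw Q μ N) + ((N : ENNReal) + 1)⁻¹ * ∫⁻ x, f x ∂μ
      = ∫⁻ x, f x ∂(cesaroLaw Q μ N)
        + ((N : ENNReal) + 1)⁻¹ * ∫⁻ x, f x ∂((Q ∘ₘ ·)^[N + 1] μ) := by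
  have hshift : ∀ n, ∫⁻ x, ∫⁻ y, f y ∂(Q x) ∂((Q ∘ₘ ·)^[n] μ)
      = ∫⁻ x, f x ∂((Q ∘ₘ ·)^[n + 1] μ) := fun n => by
    rw [Function.iterate_succ_apply', Measure.lintegral_bind Q.aemeasurable hf.aemeasurable]
  rw [Measure.lintegral_bind Q.aemeasurable hf.aemeasurable]
  simp only [lintegral_cesaroLaw, hshift]
  rw [← mul_add, ← mul_add, ← Finset.sum_range_succ]
  exact congrArg _ (Finset.sum_range_succ' (fun n => ∫⁻ x, f x ∂((Q ∘ₘ ·)^[n] μ)) _).symm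

theorem lintegral_iterate_comp_le_of_drift [IsMarkovKernel Q] {V : α → ENNReal}
    (hVm : Measurable V) {ρ b D : ENNReal} (hV : ∀ x, ∫⁻ y, V y ∂(Q x) ≤ ρ * V x + b)
    (hD : ρ * D + b ≤ D) {μ : Measure α} [IsProbabilityMeasure μ] (hμ : ∫⁻ x, V x ∂μ ≤ D)
    (n : ℕ) : ∫⁻ x, V x ∂((Q ∘ₘ ·)^[n] μ) ≤ D := by
  induction n generalizing μ with
  | zero => exact hμ
  | succ n ih =>
    rw [Function.iterate_succ_apply]
    refine ih ?_
    calc ∫⁻ x, V x ∂(Q ∘ₘ μ) = ∫⁻ x, ∫⁻ y, V y ∂(Q x) ∂μ :=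
          Measure.lintegral_bind Q.aemeasurable hVm.aemeasurable
      _ ≤ ∫⁻ x, (ρ * V x + b) ∂μ := lintegral_mono hV
      _ = ρ * ∫⁻ x, V x ∂μ + b := by
        rw [lintegral_add_right _ measurable_const, lintegral_const_mul _ hVm, lintegral_const,
          measure_univ, mul_one]
      _ ≤ ρ * D + b := by gcongr
      _ ≤ D := hD

section Topology

variable [TopologicalSpace α]

theorem lintegral_le_nndist_zero {μ : Measure α} [IsProbabilityMeasure μ]
    (f : BoundedContinuousFunction α NNReal) : ∫⁻ x, f x ∂μ ≤ nndist f 0 := by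
  rw [← mul_one (nndist f 0 : ENNReal), ← measure_univ (μ := μ), ← lintegral_const]
  exact lintegral_mono fun x =>
    ENNReal.coe_le_coe.2 (BoundedContinuousFunction.NNReal.upper_bound f x)

/-- A continuous `NNReal`-valued function bounded by `M`, as a bounded continuous function. -/
def boundedOfLE (f : C(α, NNReal)) (M : NNReal) (h : ∀ x, f x ≤ M) :
    BoundedContinuousFunction α NNReal :=
  BoundedContinuousFunction.mkOfBound f M fun x y => by
    have hdist := Real.dist_le_of_mem_Icc (x' := (0 : ℝ)) (y' := M) ⟨(f x).2, h x⟩ ⟨(f y).2, h y⟩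
    rwa [sub_zero] at hdist

variable [BorelSpace α]

theorem isClosed_lintegral_le {V : α → NNReal} (hV : Continuous V) (D : ENNReal) :
    IsClosed {μ : ProbabilityMeasure α | ∫⁻ x, V x ∂(μ : Measure α) ≤ D} := by
  let truncation (n : ℕ) := boundedOfLE ⟨fun x => min (V x) n, by fun_prop⟩ n fun _ =>
    min_le_right _ _
  have hsup : ∀ x, (V x : ENNReal) = ⨆ n, (truncation n x : ENNReal) := fun x => by
    refine le_antisymm ?_ (iSup_le fun n => ENNReal.coe_le_coe.2 (min_le_left _ _))
    obtain ⟨n, hn⟩ := exists_nat_ge (V x)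
    exact le_iSup_of_le n (ENNReal.coe_le_coe.2 (le_min le_rfl hn))
  have htrunc : ∀ μ : ProbabilityMeasure α, ∫⁻ x, V x ∂(μ : Measure α)
      = ⨆ n, ∫⁻ x, truncation n x ∂(μ : Measure α) := fun μ => by
    simp only [hsup]
    refine lintegral_iSup (fun n => (truncation n).continuous.measurable.coe_nnreal_ennreal)
      fun n m hnm x => ENNReal.coe_le_coe.2 (min_le_min_left _ (Nat.cast_le.2 hnm))
  simp only [htrunc, iSup_le_iff, Set.ofPred_forall]
  exact isClosed_iInter fun n => isClosed_le
    (ProbabilityMeasure.continuous_lintegral_boundedContinuousFunction _) continuous_const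

theorem isCompact_lintegral_le [T2Space α] {V : α → NNReal} (hV : Continuous V)
    (hVc : ∀ R : NNReal, IsCompact {x | V x ≤ R}) {D : ENNReal} (hD : D ≠ ⊤) :
    IsCompact {μ : ProbabilityMeasure α | ∫⁻ x, V x ∂(μ : Measure α) ≤ D} := by
  rw [← (isClosed_lintegral_le hV D).closure_eq]
  refine isCompact_closure_of_isTightMeasureSet
    (isTightMeasureSet_iff_exists_isCompact_measure_compl_le.2 fun ε hε => ?_)
  obtain ⟨n, hn⟩ := ENNReal.exists_nat_mul_gt hε.ne' hD
  have hn0 : (n : ENNReal) ≠ 0 := by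
    rintro h0
    simp [h0] at hn
  refine ⟨{x | V x ≤ n}, hVc n, ?_⟩
  rintro _ ⟨μ, hμ, rfl⟩
  have hmarkov : (n : ENNReal) * (μ : Measure α) {x | V x ≤ n}ᶜ ≤ n * ε :=
    calc (n : ENNReal) * (μ : Measure α) {x | V x ≤ n}ᶜ
        ≤ n * (μ : Measure α) {x | (n : ENNReal) ≤ V x} := by
          gcongr
          intro x hx
          exact ENNReal.coe_le_coe.2 (le_of_not_ge hx)
      _ ≤ ∫⁻ x, V x ∂(μ : Measure α) :=
          mul_meas_ge_le_lintegral hV.measurable.coe_nnreal_ennreal _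
      _ ≤ n * ε := hμ.trans hn.le
  exact (ENNReal.mul_le_mul_iff_right hn0 (ENNReal.natCast_ne_top n)).1 hmarkov

/-- The Feller property: `Q` maps bounded continuous functions to continuous functions. -/
def IsFeller (Q : Kernel α α) : Prop :=
  ∀ f : BoundedContinuousFunction α NNReal, Continuous fun x => ∫⁻ y, f y ∂(Q x)

theorem continuous_comp_of_isFeller [IsMarkovKernel Q] (hQ : IsFeller Q) :
    Continuous (Y := ProbabilityMeasure α) fun μ : ProbabilityMeasure α =>
      ⟨Q ∘ₘ (μ : Measure α), inferInstance⟩ := by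
  refine ProbabilityMeasure.continuous_iff_forall_continuous_lintegral.2 fun f => ?_
  have hne : ∀ x, ∫⁻ y, f y ∂(Q x) ≠ ⊤ := fun x =>
    ne_top_of_le_ne_top ENNReal.coe_ne_top (lintegral_le_nndist_zero f)
  let Qf : BoundedContinuousFunction α NNReal :=
    boundedOfLE ⟨fun x => (∫⁻ y, f y ∂(Q x)).toNNReal,
      continuous_iff_continuousAt.2 fun x =>
        (ENNReal.tendsto_toNNReal (hne x)).comp (hQ f).continuousAt⟩
      (nndist f 0) fun _ =>
        ENNReal.toNNReal_mono ENNReal.coe_ne_top (lintegral_le_nndist_zero f)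
  have hQf : ∀ μ : ProbabilityMeasure α, ∫⁻ x, f x ∂(Q ∘ₘ (μ : Measure α))
      = ∫⁻ x, Qf x ∂(μ : Measure α) := fun μ => by
    rw [Measure.lintegral_bind Q.aemeasurable
      f.continuous.measurable.coe_nnreal_ennreal.aemeasurable]
    exact lintegral_congr fun x => (ENNReal.coe_toNNReal (hne x)).symm
  simpa only [ProbabilityMeasure.coe_mk, hQf] using
    ProbabilityMeasure.continuous_lintegral_boundedContinuousFunction Qf

theorem tendsto_inv_natCast_add_one_mul {u : ℕ → ENNReal} {M : ENNReal} (hM : M ≠ ⊤)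
    (hu : ∀ n, u n ≤ M) : Tendsto (fun n : ℕ => ((n : ENNReal) + 1)⁻¹ * u n) atTop (𝓝 0) := by
  have hinv : Tendsto (fun n : ℕ => ((n : ENNReal) + 1)⁻¹) atTop (𝓝 0) := by
    simpa using (tendsto_add_atTop_iff_nat 1).2 ENNReal.tendsto_inv_nat_nhds_zero
  refine tendsto_of_tendsto_of_tendsto_of_le_of_le tendsto_const_nhds ?_ (fun _ => zero_le)
    fun n => mul_le_mul_right (hu n) _
  simpa using ENNReal.Tendsto.mul_const hinv (Or.inr hM)

theorem invariant_of_tendsto_cesaroLaw [HasOuterApproxClosed α] [IsMarkovKernel Q]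
    (hQ : IsFeller Q) {μ : Measure α} [IsProbabilityMeasure μ] {l : Filter ℕ} [l.NeBot]
    (hl : l ≤ atTop) {π : ProbabilityMeasure α}
    (hπ : Tendsto (β := ProbabilityMeasure α) (fun N => ⟨cesaroLaw Q μ N, inferInstance⟩) l (𝓝 π)) :
    Q.Invariant (π : Measure α) := by
  refine ext_of_forall_lintegral_eq_of_IsFiniteMeasure fun f => ?_
  have hboundary : ∀ m : ℕ → ℕ, Tendsto (fun N : ℕ =>
      ((N : ENNReal) + 1)⁻¹ * ∫⁻ x, f x ∂((Q ∘ₘ ·)^[m N] μ)) l (𝓝 0) := fun m =>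
    (tendsto_inv_natCast_add_one_mul ENNReal.coe_ne_top fun N =>
      lintegral_le_nndist_zero (μ := (Q ∘ₘ ·)^[m N] μ) f).mono_left hl
  have hleft := (ProbabilityMeasure.tendsto_iff_forall_lintegral_tendsto.1
    ((continuous_comp_of_isFeller hQ).continuousAt.tendsto.comp hπ) f).add (hboundary fun _ => 0)
  have hright := (ProbabilityMeasure.tendsto_iff_forall_lintegral_tendsto.1 hπ f).add
    (hboundary (· + 1))
  rw [add_zero] at hleft hright
  refine tendsto_nhds_unique (hleft.congr fun N => ?_) hright
  exact lintegral_comp_cesaroLaw_add μ N f.continuous.measurable.coe_nnreal_ennreal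

theorem exists_invariant_of_drift [T2Space α] [HasOuterApproxClosed α] [IsMarkovKernel Q]
    (hQ : IsFeller Q) {V : α → NNReal} (hVc : Continuous V)
    (hVK : ∀ R : NNReal, IsCompact {x | V x ≤ R}) {ρ b D : ENNReal}
    (hV : ∀ x, ∫⁻ y, V y ∂(Q x) ≤ ρ * V x + b) (hD : ρ * D + b ≤ D) (hDtop : D ≠ ⊤)
    {μ : Measure α} [IsProbabilityMeasure μ] (hμ : ∫⁻ x, V x ∂μ ≤ D) :
    ∃ π : Measure α, IsProbabilityMeasure π ∧ Q.Invariant π ∧ ∫⁻ x, V x ∂π ≤ D := by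
  let average (N : ℕ) : ProbabilityMeasure α := ⟨cesaroLaw Q μ N, inferInstance⟩
  have hmem : ∀ N, average N ∈ {κ : ProbabilityMeasure α | ∫⁻ x, V x ∂(κ : Measure α) ≤ D} :=
    lintegral_cesaroLaw_le
      (lintegral_iterate_comp_le_of_drift hVc.measurable.coe_nnreal_ennreal hV hD hμ)
  obtain ⟨π, hπD, hπ⟩ := (isCompact_lintegral_le hVc hVK hDtop).ultrafilter_le_nhds
    ((hyperfilter ℕ).map average) (le_principal_iff.2 (mem_map.2 (Eventually.of_forall hmem)))
  exact ⟨π, inferInstance, invariant_of_tendsto_cesaroLaw hQ Nat.hyperfilter_le_atTop hπ, hπD⟩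

end Topology

end InvariantMeasure

/-! ### Exponential tilting and convolution -/

section Convolution

variable {M : Type*} [AddMonoid M] [MeasurableSpace M] [MeasurableAdd₂ M] {μ κ : Measure M}

theorem withDensity_conv_withDensity [SFinite κ] {f g h : M → ENNReal}
    (hf : Measurable f) (hg : Measurable g) (hh : Measurable h)
    (hfgh : ∀ u v, f u * g v = h (u + v)) :
    (μ.withDensity f).conv (κ.withDensity g) = (μ.conv κ).withDensity h := by
  refine Measure.ext_of_lintegral _ fun φ hφ => ?_
  rw [Measure.lintegral_conv hφ, lintegral_withDensity_eq_lintegral_mul _ hh hφ,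
    Measure.lintegral_conv (hh.mul hφ),
    lintegral_withDensity_eq_lintegral_mul _ hf (by fun_prop)]
  refine lintegral_congr fun u => ?_
  rw [Pi.mul_apply, lintegral_withDensity_eq_lintegral_mul _ hg (by fun_prop),
    ← lintegral_const_mul _ (by fun_prop)]
  exact lintegral_congr fun v => by rw [Pi.mul_apply, Pi.mul_apply, ← mul_assoc, hfgh]

theorem lintegral_conv_of_add [IsProbabilityMeasure μ] [IsProbabilityMeasure κ]
    {V : M → ENNReal} (hV : Measurable V) (hadd : ∀ u v, V (u + v) = V u + V v) :
    ∫⁻ y, V y ∂(μ.conv κ) = ∫⁻ y, V y ∂μ + ∫⁻ y, V y ∂κ := by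
  rw [Measure.lintegral_conv hV]
  simp only [hadd, lintegral_add_left measurable_const, lintegral_const, measure_univ, mul_one]
  rw [lintegral_add_right _ measurable_const, lintegral_const, measure_univ, mul_one]

theorem conv_singleton_add_ne_zero [MeasurableSingletonClass M] [SFinite κ] {u v : M}
    (hu : μ {u} ≠ 0) (hv : κ {v} ≠ 0) : (μ.conv κ) {u + v} ≠ 0 := by
  intro h
  rw [Measure.conv, Measure.map_apply measurable_add (measurableSet_singleton _)] at h
  have hsub : ({u} ×ˢ {v} : Set (M × M)) ⊆ (fun z : M × M => z.1 + z.2) ⁻¹' {u + v} := by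
    rintro ⟨a, b⟩ ⟨rfl, rfl⟩
    rfl
  have hprod := measure_mono_null hsub h
  rw [Measure.prod_prod] at hprod
  exact mul_ne_zero hu hv hprod

end Convolution

section ConvPow

variable {μ : Measure Pop}

instance sFinite_convPow [SFinite μ] (n : ℕ) : SFinite (convPow μ n) := by
  induction n with
  | zero => exact inferInstanceAs (SFinite (Measure.dirac 0))
  | succ n ih => exact inferInstanceAs (SFinite ((convPow μ n).conv μ))

instance isProbabilityMeasure_convPow [IsProbabilityMeasure μ] (n : ℕ) :
    IsProbabilityMeasure (convPow μ n) := by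
  induction n with
  | zero => exact inferInstanceAs (IsProbabilityMeasure (Measure.dirac 0))
  | succ n ih => exact inferInstanceAs (IsProbabilityMeasure ((convPow μ n).conv μ))

theorem lintegral_convPow_of_add [IsProbabilityMeasure μ] {V : Pop → ENNReal} (h0 : V 0 = 0)
    (hadd : ∀ u v, V (u + v) = V u + V v) (n : ℕ) :
    ∫⁻ y, V y ∂(convPow μ n) = n * ∫⁻ y, V y ∂μ := by
  induction n with
  | zero => simp [convPow, h0]
  | succ n ih =>
    rw [convPow, lintegral_conv_of_add .of_discrete hadd, ih, Nat.cast_add_one, add_mul, one_mul]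

theorem convPow_withDensity [SFinite μ] {F : ℕ → Pop → ENNReal} (h0 : F 0 0 = 1)
    (hF : ∀ n u v, F n u * F 1 v = F (n + 1) (u + v)) (n : ℕ) :
    convPow (μ.withDensity (F 1)) n = (convPow μ n).withDensity (F n) := by
  induction n with
  | zero => rw [convPow, convPow, dirac_withDensity, h0, one_smul]
  | succ n ih =>
    rw [convPow, convPow, ih]
    exact withDensity_conv_withDensity .of_discrete .of_discrete .of_discrete (hF n)

theorem convPow_singleton_nsmul_ne_zero [SFinite μ] {u : Pop} (hu : μ {u} ≠ 0) (n : ℕ) :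
    convPow μ n {n • u} ≠ 0 := by
  induction n with
  | zero => simp [convPow]
  | succ n ih =>
    rw [convPow, succ_nsmul]
    exact conv_singleton_add_ne_zero ih hu

end ConvPow

/-! ### Negative multinomial series -/

section Series

open Finset.HasAntidiagonal (antidiagonal mem_antidiagonal)

theorem tsum_prod_eq_tsum_antidiagonal (f : ℕ × ℕ → ENNReal) :
    ∑' x, f x = ∑' n, ∑ x ∈ antidiagonal n, f x := by
  rw [← Finset.HasAntidiagonal.sigmaAntidiagonalEquivProd.tsum_eq, ENNReal.tsum_sigma']
  refine tsum_congr fun n => ?_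
  rw [tsum_fintype]
  exact Finset.sum_coe_sort (antidiagonal n) f

theorem sum_antidiagonal_choose_mul_pow (p q : ENNReal) (n : ℕ) :
    ∑ x ∈ antidiagonal n, ((x.1 + x.2).choose x.1 : ENNReal) * (p ^ x.1 * q ^ x.2)
      = (p + q) ^ n := by
  rw [(Commute.all p q).add_pow']
  refine Finset.sum_congr rfl fun x hx => ?_
  rw [mem_antidiagonal.1 hx, nsmul_eq_mul]

theorem tsum_choose_mul_pow (p q : ENNReal) :
    ∑' x : ℕ × ℕ, ((x.1 + x.2).choose x.1 : ENNReal) * (p ^ x.1 * q ^ x.2)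
      = (1 - (p + q))⁻¹ := by
  simp only [tsum_prod_eq_tsum_antidiagonal, sum_antidiagonal_choose_mul_pow,
    ENNReal.tsum_geometric]

theorem tsum_succ_mul_pow (q : ENNReal) :
    ∑' n : ℕ, ((n : ENNReal) + 1) * q ^ n = (1 - q)⁻¹ ^ 2 := by
  have hsum : ∀ n : ℕ, ∑ x ∈ antidiagonal n, q ^ x.1 * q ^ x.2 = (n + 1) * q ^ n := fun n => by
    rw [Finset.sum_congr rfl fun x hx => by rw [← pow_add, mem_antidiagonal.1 hx]]
    simp
  calc ∑' n : ℕ, ((n : ENNReal) + 1) * q ^ n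
      = ∑' x : ℕ × ℕ, q ^ x.1 * q ^ x.2 := by simp only [tsum_prod_eq_tsum_antidiagonal, hsum]
    _ = (1 - q)⁻¹ ^ 2 := by
      rw [ENNReal.tsum_prod (f := fun a b : ℕ => q ^ a * q ^ b)]
      simp only [ENNReal.tsum_mul_left, ENNReal.tsum_mul_right, ENNReal.tsum_geometric, sq]

theorem tsum_fst_mul_choose_mul_pow (p q : ENNReal) :
    ∑' x : ℕ × ℕ, (x.1 : ENNReal) * (((x.1 + x.2).choose x.1 : ENNReal) * (p ^ x.1 * q ^ x.2))
      = p * (1 - (p + q))⁻¹ ^ 2 := by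
  have absorb : ∀ a b : ℕ, ((a + 1 : ℕ) : ENNReal) * ((a + 1 + b).choose (a + 1) : ENNReal)
      = ((a + b : ℕ) + 1) * ((a + b).choose a : ENNReal) := fun a b => by
    have h := Nat.add_one_mul_choose_eq (a + b) a
    rw [mul_comm (Nat.choose _ _) (a + 1), add_right_comm a b 1, eq_comm] at h
    exact_mod_cast h.trans (by ring)
  calc ∑' x : ℕ × ℕ, (x.1 : ENNReal) * (((x.1 + x.2).choose x.1 : ENNReal) * (p ^ x.1 * q ^ x.2))
      = ∑' x : ℕ × ℕ, ((x.1 + 1 : ℕ) : ENNReal)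
          * (((x.1 + 1 + x.2).choose (x.1 + 1) : ENNReal) * (p ^ (x.1 + 1) * q ^ x.2)) := by
        rw [ENNReal.tsum_prod (f := fun a b : ℕ =>
            (a : ENNReal) * (((a + b).choose a : ENNReal) * (p ^ a * q ^ b))),
          ENNReal.tsum_prod (f := fun a b : ℕ => ((a + 1 : ℕ) : ENNReal)
            * (((a + 1 + b).choose (a + 1) : ENNReal) * (p ^ (a + 1) * q ^ b))),
          tsum_eq_zero_add' ENNReal.summable]
        simp
    _ = ∑' x : ℕ × ℕ, p * (((x.1 + x.2 : ℕ) + 1)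
          * (((x.1 + x.2).choose x.1 : ENNReal) * (p ^ x.1 * q ^ x.2))) :=
        tsum_congr fun x => by rw [← mul_assoc, absorb, pow_succ]; ring
    _ = p * ∑' n : ℕ, ((n : ENNReal) + 1) * (p + q) ^ n := by
        rw [ENNReal.tsum_mul_left, tsum_prod_eq_tsum_antidiagonal]
        congr 2 with n
        rw [← sum_antidiagonal_choose_mul_pow, Finset.mul_sum]
        exact Finset.sum_congr rfl fun x hx => by rw [mem_antidiagonal.1 hx]
    _ = p * (1 - (p + q))⁻¹ ^ 2 := by rw [tsum_succ_mul_pow]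

theorem tsum_snd_mul_choose_mul_pow (p q : ENNReal) :
    ∑' x : ℕ × ℕ, (x.2 : ENNReal) * (((x.1 + x.2).choose x.1 : ENNReal) * (p ^ x.1 * q ^ x.2))
      = q * (1 - (p + q))⁻¹ ^ 2 := by
  rw [← (Equiv.prodComm ℕ ℕ).tsum_eq, add_comm p q, ← tsum_fst_mul_choose_mul_pow]
  refine tsum_congr fun x => ?_
  simp only [Equiv.prodComm_apply, Prod.fst_swap, Prod.snd_swap]
  rw [add_comm x.2 x.1, Nat.choose_symm_add, mul_comm (p ^ x.2)]

end Series

/-! ### Quenched and annealed transition laws -/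

theorem left2_nonneg (w : SiteLaw) : 0 ≤ left2 w := w.2.1 0

theorem left1_nonneg (w : SiteLaw) : 0 ≤ left1 w := w.2.1 1

theorem right1_nonneg (w : SiteLaw) : 0 ≤ right1 w := w.2.1 2

theorem left1_add_left2_add_right1 (w : SiteLaw) : left1 w + left2 w + right1 w = 1 := by
  have h := w.2.2
  rw [Fin.sum_univ_three] at h
  rw [← h, left1, left2, right1, add_comm (w.1 1)]

theorem left2_le_one (w : SiteLaw) : left2 w ≤ 1 := by
  linarith [left1_add_left2_add_right1 w, left1_nonneg w, right1_nonneg w]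

theorem left1_le_one (w : SiteLaw) : left1 w ≤ 1 := by
  linarith [left1_add_left2_add_right1 w, left2_nonneg w, right1_nonneg w]

theorem right1_le_one (w : SiteLaw) : right1 w ≤ 1 := by
  linarith [left1_add_left2_add_right1 w, left2_nonneg w, left1_nonneg w]

@[fun_prop]
theorem continuous_left2 : Continuous left2 :=
  (continuous_apply 0).comp continuous_subtype_val

@[fun_prop]
theorem continuous_left1 : Continuous left1 :=
  (continuous_apply 1).comp continuous_subtype_val

@[fun_prop]
theorem continuous_right1 : Continuous right1 :=
  (continuous_apply 2).comp continuous_subtype_val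

/-- The monomial `w(-1)^i w(-2)^j w(1)^n` in the jump probabilities. -/
noncomputable def siteMonomial (i j n : ℕ) (w : SiteLaw) : ℝ :=
  left1 w ^ i * left2 w ^ j * right1 w ^ n

@[fun_prop]
theorem continuous_siteMonomial (i j n : ℕ) : Continuous (siteMonomial i j n) := by
  unfold siteMonomial
  fun_prop

theorem siteMonomial_nonneg (i j n : ℕ) (w : SiteLaw) : 0 ≤ siteMonomial i j n w :=
  mul_nonneg (mul_nonneg (pow_nonneg (left1_nonneg w) _) (pow_nonneg (left2_nonneg w) _))
    (pow_nonneg (right1_nonneg w) _)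

theorem siteMonomial_le_one (i j n : ℕ) (w : SiteLaw) : siteMonomial i j n w ≤ 1 :=
  mul_le_one₀ (mul_le_one₀ (pow_le_one₀ (left1_nonneg w) (left1_le_one w))
    (pow_nonneg (left2_nonneg w) _) (pow_le_one₀ (left2_nonneg w) (left2_le_one w)))
    (pow_nonneg (right1_nonneg w) _) (pow_le_one₀ (right1_nonneg w) (right1_le_one w))

theorem ofReal_siteMonomial_mul (i j n i' j' n' : ℕ) (w : SiteLaw) :
    ENNReal.ofReal (siteMonomial i j n w) * ENNReal.ofReal (siteMonomial i' j' n' w)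
      = ENNReal.ofReal (siteMonomial (i + i') (j + j') (n + n') w) := by
  rw [← ENNReal.ofReal_mul (siteMonomial_nonneg _ _ _ _)]
  congr 1
  unfold siteMonomial
  ring

theorem integrable_siteMonomial (ν : ProbabilityMeasure SiteLaw) (i j n : ℕ) :
    Integrable (siteMonomial i j n) (ν : Measure SiteLaw) :=
  .of_bound (by fun_prop) 1 (.of_forall fun w => by
    rw [Real.norm_of_nonneg (siteMonomial_nonneg _ _ _ _)]
    exact siteMonomial_le_one _ _ _ _)

/-- The environment-free part of `offspringWith`: it gives mass `(a+b)!/(a! b!)` to `(a,b,c)`. -/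
noncomputable def offspringCoeff (c : ℕ) : Measure Pop :=
  Measure.sum fun ab : ℕ × ℕ =>
    ((ab.1 + ab.2).choose ab.1 : ENNReal) • Measure.dirac (![ab.1, ab.2, c] : Pop)

instance sFinite_offspringCoeff (c : ℕ) : SFinite (offspringCoeff c) := by
  unfold offspringCoeff
  infer_instance

theorem offspringCoeff_singleton_ne_zero (a b c : ℕ) : offspringCoeff c {![a, b, c]} ≠ 0 := by
  rw [offspringCoeff, Measure.sum_apply _ (measurableSet_singleton _)]
  intro h
  have hab : (a + b).choose a = 0 := by simpa using ENNReal.tsum_eq_zero.1 h (a, b)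
  exact (Nat.choose_pos (Nat.le_add_right a b)).ne' hab

theorem offspringWith_eq_withDensity (w : SiteLaw) (c : ℕ) :
    offspringWith w c = (offspringCoeff c).withDensity
      fun y => ENNReal.ofReal (siteMonomial (y 0) (y 1) 1 w) := by
  rw [offspringWith, offspringCoeff, withDensity_sum]
  congr with ab : 1
  rw [withDensity_smul_measure, dirac_withDensity, smul_smul, ← ENNReal.ofReal_natCast,
    ← ENNReal.ofReal_mul (Nat.cast_nonneg _)]
  congr 2
  simp only [siteMonomial, Matrix.cons_val_zero, Matrix.cons_val_one, pow_one]
  ring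

theorem lintegral_offspringWith (w : SiteLaw) (c : ℕ) (f : Pop → ENNReal) :
    ∫⁻ y, f y ∂(offspringWith w c) = ENNReal.ofReal (right1 w) * ∑' x : ℕ × ℕ,
      f ![x.1, x.2, c] * (((x.1 + x.2).choose x.1 : ENNReal) *
        (ENNReal.ofReal (left1 w) ^ x.1 * ENNReal.ofReal (left2 w) ^ x.2)) := by
  have hmass : ∀ a b : ℕ, ENNReal.ofReal
      ((a + b).choose a * left1 w ^ a * left2 w ^ b * right1 w)
      = ENNReal.ofReal (right1 w) * (((a + b).choose a : ENNReal) *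
        (ENNReal.ofReal (left1 w) ^ a * ENNReal.ofReal (left2 w) ^ b)) := fun a b => by
    have := left1_nonneg w
    have := left2_nonneg w
    rw [ENNReal.ofReal_mul (by positivity), ENNReal.ofReal_mul (by positivity),
      ENNReal.ofReal_mul (by positivity), ENNReal.ofReal_natCast,
      ENNReal.ofReal_pow (left1_nonneg w), ENNReal.ofReal_pow (left2_nonneg w)]
    ring
  rw [offspringWith, lintegral_sum_measure, ← ENNReal.tsum_mul_left]
  refine tsum_congr fun x => ?_
  rw [lintegral_smul_measure, lintegral_dirac, hmass, smul_eq_mul]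
  ring

theorem inv_one_sub_ofReal_left (w : SiteLaw) :
    (1 - (ENNReal.ofReal (left1 w) + ENNReal.ofReal (left2 w)))⁻¹
      = (ENNReal.ofReal (right1 w))⁻¹ := by
  rw [← ENNReal.ofReal_add (left1_nonneg w) (left2_nonneg w), ← ENNReal.ofReal_one,
    ← ENNReal.ofReal_sub _ (add_nonneg (left1_nonneg w) (left2_nonneg w)),
    ← left1_add_left2_add_right1 w, add_sub_cancel_left]

theorem isProbabilityMeasure_offspringWith {w : SiteLaw} (hw : 0 < right1 w) (c : ℕ) :
    IsProbabilityMeasure (offspringWith w c) := by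
  constructor
  rw [← lintegral_one, lintegral_offspringWith]
  simp only [one_mul]
  rw [tsum_choose_mul_pow, inv_one_sub_ofReal_left]
  exact ENNReal.mul_inv_cancel (by simpa using hw) ENNReal.ofReal_ne_top

/-- The exponent of `w(1)` in `logWeight`: the number of individuals of the generation `x` that
reproduce, immigrant included. -/
def parents (x : Pop) : ℕ := x 0 + x 1 + x 2 + 1

/-- The environment-free part of `quenchedStep`. -/
noncomputable def stepCoeff (x : Pop) : Measure Pop :=
  ((convPow (offspringCoeff 0) (1 + x 0)).conv (convPow (offspringCoeff 1) (x 1))).conv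
    (convPow (offspringCoeff 0) (x 2))

theorem convPow_offspringWith (w : SiteLaw) (c n : ℕ) :
    convPow (offspringWith w c) n = (convPow (offspringCoeff c) n).withDensity
      fun y => ENNReal.ofReal (siteMonomial (y 0) (y 1) n w) := by
  rw [offspringWith_eq_withDensity]
  exact convPow_withDensity (F := fun n y => ENNReal.ofReal (siteMonomial (y 0) (y 1) n w))
    (by simp [siteMonomial]) (fun _ _ _ => ofReal_siteMonomial_mul _ _ _ _ _ _ w) n

theorem quenchedStep_eq_withDensity (w : SiteLaw) (x : Pop) :
    quenchedStep w x = (stepCoeff x).withDensity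
      fun y => ENNReal.ofReal (siteMonomial (y 0) (y 1) (parents x) w) := by
  have hconv : ∀ (μ κ : Measure Pop) [SFinite κ] (m n : ℕ),
      (μ.withDensity fun y => ENNReal.ofReal (siteMonomial (y 0) (y 1) m w)).conv
        (κ.withDensity fun y => ENNReal.ofReal (siteMonomial (y 0) (y 1) n w))
      = (μ.conv κ).withDensity fun y => ENNReal.ofReal (siteMonomial (y 0) (y 1) (m + n) w) :=
    fun μ κ _ m n => withDensity_conv_withDensity .of_discrete .of_discrete .of_discrete
      fun _ _ => ofReal_siteMonomial_mul _ _ _ _ _ _ w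
  have hparents : 1 + x 0 + x 1 + x 2 = parents x := by rw [parents]; ring
  simp only [quenchedStep, offspring, convPow_offspringWith, hconv, stepCoeff, hparents]
  rfl

theorem quenchedStep_singleton (w : SiteLaw) (x y : Pop) :
    quenchedStep w x {y}
      = ENNReal.ofReal (siteMonomial (y 0) (y 1) (parents x) w) * stepCoeff x {y} := by
  rw [quenchedStep_eq_withDensity, withDensity_apply _ (measurableSet_singleton y),
    lintegral_singleton]

theorem isProbabilityMeasure_quenchedStep {w : SiteLaw} (hw : 0 < right1 w) (x : Pop) :
    IsProbabilityMeasure (quenchedStep w x) := by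
  have : ∀ i, IsProbabilityMeasure (offspring w i) := fun _ =>
    isProbabilityMeasure_offspringWith hw _
  unfold quenchedStep
  infer_instance

theorem stepCoeff_singleton_ne_zero (x : Pop) : stepCoeff x {![0, 0, x 1]} ≠ 0 := by
  have hsum : (1 + x 0) • (![0, 0, 0] : Pop) + x 1 • ![0, 0, 1] + x 2 • ![0, 0, 0]
      = ![0, 0, x 1] := by
    ext i
    fin_cases i <;> simp
  rw [← hsum, stepCoeff]
  have hpow := fun c n => convPow_singleton_nsmul_ne_zero (offspringCoeff_singleton_ne_zero 0 0 c) n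
  exact conv_singleton_add_ne_zero
    (conv_singleton_add_ne_zero (hpow 0 _) (hpow 1 _)) (hpow 0 _)

theorem stepCoeff_zero : stepCoeff 0 = offspringCoeff 0 := by
  simp [stepCoeff, convPow]

/-- The function `exp φ̃_θ`, for `ν = ν_θ`; see `logWeight`. -/
noncomputable def annealedWeight (ν : ProbabilityMeasure SiteLaw) (z : Pop × Pop) : ℝ :=
  ∫ w, siteMonomial (z.2 0) (z.2 1) (parents z.1) w ∂(ν : Measure SiteLaw)

theorem logWeight_eq_log_annealedWeight (ν : ProbabilityMeasure SiteLaw) (z : Pop × Pop) :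
    logWeight ν z = Real.log (annealedWeight ν z) := rfl

theorem transition_apply_singleton (ν : ProbabilityMeasure SiteLaw) (x y : Pop) :
    transition ν x {y} = ∫⁻ w, quenchedStep w x {y} ∂(ν : Measure SiteLaw) :=
  Measure.sum_smul_dirac_singleton

theorem lintegral_transition (ν : ProbabilityMeasure SiteLaw) (x : Pop) (f : Pop → ENNReal) :
    ∫⁻ y, f y ∂(transition ν x) = ∫⁻ w, ∫⁻ y, f y ∂(quenchedStep w x) ∂(ν : Measure SiteLaw) := by
  have hmeas : ∀ y, Measurable fun w => quenchedStep w x {y} := fun y => by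
    simp only [quenchedStep_singleton]
    fun_prop
  simp only [lintegral_countable', transition_apply_singleton]
  rw [lintegral_tsum fun y => ((hmeas y).const_mul _).aemeasurable]
  exact tsum_congr fun y => (lintegral_const_mul _ (hmeas y)).symm

theorem transition_eq_withDensity (ν : ProbabilityMeasure SiteLaw) (x : Pop) :
    transition ν x
      = (stepCoeff x).withDensity fun y => ENNReal.ofReal (annealedWeight ν (x, y)) := by
  refine Measure.ext_of_singleton fun y => ?_
  rw [transition_apply_singleton, withDensity_apply _ (measurableSet_singleton y),
    lintegral_singleton, annealedWeight, ofReal_integral_eq_lintegral_ofReal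
      (integrable_siteMonomial _ _ _ _) (.of_forall (siteMonomial_nonneg _ _ _)),
    ← lintegral_mul_const _ (by fun_prop)]
  simp only [quenchedStep_singleton]

theorem isMarkovKernel_transition {ν : ProbabilityMeasure SiteLaw}
    (hν : ∀ᵐ w ∂(ν : Measure SiteLaw), 0 < right1 w) : IsMarkovKernel (transition ν) := by
  refine ⟨fun x => ⟨?_⟩⟩
  rw [← lintegral_one, lintegral_transition]
  have hmass : ∀ᵐ w ∂(ν : Measure SiteLaw), ∫⁻ _, 1 ∂(quenchedStep w x) = 1 :=
    hν.mono fun w hw => by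
      have := isProbabilityMeasure_quenchedStep hw x
      rw [lintegral_one, measure_univ]
  rw [lintegral_congr_ae hmass, lintegral_one, measure_univ]

theorem annealedWeight_pos_of_siteMonomial_pos {ν : ProbabilityMeasure SiteLaw} {z : Pop × Pop}
    (hz : ∀ᵐ w ∂(ν : Measure SiteLaw), 0 < siteMonomial (z.2 0) (z.2 1) (parents z.1) w) :
    0 < annealedWeight ν z := by
  refine (integral_nonneg (siteMonomial_nonneg _ _ _)).lt_of_ne' fun h0 => ?_
  have hae := (integral_eq_zero_iff_of_nonneg (siteMonomial_nonneg _ _ _)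
    (integrable_siteMonomial ν _ _ _)).1 h0
  obtain ⟨w, hw, hpos⟩ := (hae.and hz).exists
  exact hpos.ne' hw

theorem transition_singleton_ne_zero {ν : ProbabilityMeasure SiteLaw}
    (hν : ∀ᵐ w ∂(ν : Measure SiteLaw), 0 < right1 w) (x : Pop) :
    transition ν x {![0, 0, x 1]} ≠ 0 := by
  rw [transition_eq_withDensity, withDensity_apply _ (measurableSet_singleton _),
    lintegral_singleton]
  refine mul_ne_zero (ENNReal.ofReal_pos.2 ?_).ne' (stepCoeff_singleton_ne_zero x)
  exact annealedWeight_pos_of_siteMonomial_pos (hν.mono fun w hw => by simp [siteMonomial, hw])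

/-- Childlessness of all individuals, twice in a row, empties the population. -/
theorem isAccessible_zero {ν : ProbabilityMeasure SiteLaw}
    (hν : ∀ᵐ w ∂(ν : Measure SiteLaw), 0 < right1 w) : IsAccessible (transition ν) 0 := fun x => by
  have hzero : (![0, 0, (![0, 0, x 1] : Pop) 1] : Pop) = 0 := by
    ext i
    fin_cases i <;> rfl
  exact .tail (.single (transition_singleton_ne_zero hν x))
    (hzero ▸ transition_singleton_ne_zero hν ![0, 0, x 1])

/-- Almost surely all three jumps have positive probability. -/
def Elliptic (ν : ProbabilityMeasure SiteLaw) : Prop :=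
  ∀ᵐ w ∂(ν : Measure SiteLaw), 0 < left1 w ∧ 0 < left2 w ∧ 0 < right1 w

theorem annealedWeight_pos {ν : ProbabilityMeasure SiteLaw} (hν : Elliptic ν) (z : Pop × Pop) :
    0 < annealedWeight ν z :=
  annealedWeight_pos_of_siteMonomial_pos (hν.mono fun w ⟨h1, h2, hr⟩ => by
    unfold siteMonomial
    positivity)

/-! ### Ballisticity bounds the mean offspring -/

section Environment

variable (ν : ProbabilityMeasure SiteLaw)

theorem measurePreserving_eval_envLaw (i : ℤ) :
    MeasurePreserving (fun ω : Env => ω i) (envLaw ν) (ν : Measure SiteLaw) :=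
  measurePreserving_eval_infinitePi (fun _ : ℤ => (ν : Measure SiteLaw)) i

/-- The information carried by the sites up to a given one. -/
noncomputable def siteFiltration : Filtration ℤ (inferInstance : MeasurableSpace Env) :=
  Filtration.natural (fun i ω => ω i) fun i => (measurable_pi_apply i).stronglyMeasurable

theorem measurable_siteFiltration_eval {i j : ℤ} (hij : i ≤ j) :
    Measurable[siteFiltration j] fun ω : Env => ω i :=
  ((Filtration.stronglyAdapted_natural fun i =>
    (measurable_pi_apply i).stronglyMeasurable) i).measurable.mono (siteFiltration.mono hij) le_rfl

theorem lintegral_envLaw_mul {i j : ℤ} (hij : i < j) {g : SiteLaw → ENNReal} (hg : Measurable g)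
    {F : Env → ENNReal} (hF : Measurable[siteFiltration i] F) :
    ∫⁻ ω, g (ω j) * F ω ∂(envLaw ν)
      = (∫⁻ w, g w ∂(ν : Measure SiteLaw)) * ∫⁻ ω, F ω ∂(envLaw ν) := by
  have hiind : iIndepFun (fun (i : ℤ) (ω : Env) => ω i) (envLaw ν) :=
    iIndepFun_infinitePi (X := fun _ w => w) fun _ => measurable_id
  have hind := indep_iSup_of_disjoint (fun i => (measurable_pi_apply i).comap_le) hiind
    (S := {j}) (T := Set.Iic i) (by simpa using hij)
  rw [iSup_singleton] at hind
  rw [← (measurePreserving_eval_envLaw ν j).lintegral_comp hg]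
  exact lintegral_mul_eq_lintegral_mul_lintegral_of_independent_measurableSpace
    (measurable_pi_apply j).comap_le (siteFiltration.le i) hind (hg.comp (comap_measurable _)) hF

end Environment

/-- The vector `A_k ⋯ A_1 (2,1,2)ᵗ` whose first entry is the `k`-th term of `hittingSeries`. -/
noncomputable def hittingVec (ω : Env) (k : ℕ) : Fin 3 → ℝ :=
  (prodDown ω k).mulVec ![2, 1, 2]

section HittingVec

variable (ω : Env) (k : ℕ)

theorem hittingVec_zero : hittingVec ω 0 = ![2, 1, 2] := by
  rw [hittingVec, prodDown, Matrix.one_mulVec]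

theorem hittingVec_succ :
    hittingVec ω (k + 1) = (matA (ω (k + 1))).mulVec (hittingVec ω k) := by
  rw [hittingVec, prodDown, ← Matrix.mulVec_mulVec, hittingVec]

theorem hittingVec_succ_apply_zero :
    hittingVec ω (k + 1) 0 = left1 (ω (k + 1)) / right1 (ω (k + 1)) * hittingVec ω k 0
      + left2 (ω (k + 1)) / right1 (ω (k + 1)) * hittingVec ω k 1 := by
  rw [hittingVec_succ]
  simp [matA, Matrix.mulVec, dotProduct, Fin.sum_univ_three]

theorem hittingVec_apply_two : hittingVec ω k 2 = hittingVec ω k 0 := by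
  cases k with
  | zero => rw [hittingVec_zero]; rfl
  | succ k =>
    rw [hittingVec_succ]
    simp [matA, Matrix.mulVec, dotProduct, Fin.sum_univ_three]

theorem hittingVec_succ_apply_one :
    hittingVec ω (k + 1) 1 = hittingVec ω (k + 1) 0 + hittingVec ω k 0 := by
  rw [hittingVec_succ_apply_zero, hittingVec_succ]
  simp [matA, Matrix.mulVec, dotProduct, Fin.sum_univ_three, hittingVec_apply_two]

theorem hittingVec_nonneg : 0 ≤ hittingVec ω k 0 ∧ 0 ≤ hittingVec ω k 1 := by
  induction k with
  | zero => simp [hittingVec_zero]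
  | succ k ih =>
    have h0 : 0 ≤ hittingVec ω (k + 1) 0 := by
      rw [hittingVec_succ_apply_zero]
      exact add_nonneg (mul_nonneg (div_nonneg (left1_nonneg _) (right1_nonneg _)) ih.1)
        (mul_nonneg (div_nonneg (left2_nonneg _) (right1_nonneg _)) ih.2)
    exact ⟨h0, hittingVec_succ_apply_one ω k ▸ add_nonneg h0 ih.1⟩

end HittingVec

@[fun_prop]
theorem measurable_left1_div_right1 : Measurable fun w => left1 w / right1 w :=
  continuous_left1.measurable.div continuous_right1.measurable

@[fun_prop]
theorem measurable_left2_div_right1 : Measurable fun w => left2 w / right1 w :=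
  continuous_left2.measurable.div continuous_right1.measurable

theorem measurable_siteFiltration_hittingVec (k : ℕ) :
    Measurable[siteFiltration k] (fun ω => hittingVec ω k 0) ∧
      Measurable[siteFiltration k] (fun ω => hittingVec ω k 1) := by
  induction k with
  | zero => simp only [hittingVec_zero, measurable_const, and_self]
  | succ k ih =>
    have hle : siteFiltration k ≤ siteFiltration (k + 1 : ℕ) := siteFiltration.mono (by simp)
    have h0 := ih.1.mono hle le_rfl
    have h1 := ih.2.mono hle le_rfl
    have heval : Measurable[siteFiltration (k + 1 : ℕ)] fun ω : Env => ω (k + 1) :=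
      measurable_siteFiltration_eval (by simp)
    have hsucc : Measurable[siteFiltration (k + 1 : ℕ)] fun ω => hittingVec ω (k + 1) 0 := by
      simp only [hittingVec_succ_apply_zero]
      exact ((measurable_left1_div_right1.comp heval).mul h0).add
        ((measurable_left2_div_right1.comp heval).mul h1)
    refine ⟨hsucc, ?_⟩
    simp only [hittingVec_succ_apply_one]
    exact hsucc.add h0

theorem measurable_hittingVec_apply_zero (k : ℕ) : Measurable fun ω => hittingVec ω k 0 :=
  (measurable_siteFiltration_hittingVec k).1.mono (siteFiltration.le _) le_rfl

theorem lintegral_hittingVec_succ_apply_zero (ν : ProbabilityMeasure SiteLaw) (k : ℕ) :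
    ∫⁻ ω, ENNReal.ofReal (hittingVec ω (k + 1) 0) ∂(envLaw ν)
      = (∫⁻ w, ENNReal.ofReal (left1 w / right1 w) ∂(ν : Measure SiteLaw))
          * ∫⁻ ω, ENNReal.ofReal (hittingVec ω k 0) ∂(envLaw ν)
        + (∫⁻ w, ENNReal.ofReal (left2 w / right1 w) ∂(ν : Measure SiteLaw))
          * ∫⁻ ω, ENNReal.ofReal (hittingVec ω k 1) ∂(envLaw ν) := by
  have hlt : (k : ℤ) < k + 1 := lt_add_one _
  obtain ⟨hm0, hm1⟩ := measurable_siteFiltration_hittingVec k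
  rw [← lintegral_envLaw_mul ν hlt (by fun_prop) hm0.ennreal_ofReal,
    ← lintegral_envLaw_mul ν hlt (by fun_prop) hm1.ennreal_ofReal, ← lintegral_add_left]
  · refine lintegral_congr fun ω => ?_
    obtain ⟨h0, h1⟩ := hittingVec_nonneg ω k
    have ha := div_nonneg (left1_nonneg (ω (k + 1))) (right1_nonneg (ω (k + 1)))
    have hb := div_nonneg (left2_nonneg (ω (k + 1))) (right1_nonneg (ω (k + 1)))
    rw [hittingVec_succ_apply_zero, ENNReal.ofReal_add (mul_nonneg ha h0) (mul_nonneg hb h1),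
      ENNReal.ofReal_mul ha, ENNReal.ofReal_mul hb]
  · exact (measurable_left1_div_right1.comp (measurable_pi_apply (k + 1 : ℤ))).ennreal_ofReal.mul
      (measurable_hittingVec_apply_zero k).ennreal_ofReal

theorem lintegral_hittingVec_succ_apply_one (ν : ProbabilityMeasure SiteLaw) (k : ℕ) :
    ∫⁻ ω, ENNReal.ofReal (hittingVec ω (k + 1) 1) ∂(envLaw ν)
      = ∫⁻ ω, ENNReal.ofReal (hittingVec ω (k + 1) 0) ∂(envLaw ν)
        + ∫⁻ ω, ENNReal.ofReal (hittingVec ω k 0) ∂(envLaw ν) := by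
  rw [← lintegral_add_left (measurable_hittingVec_apply_zero _).ennreal_ofReal]
  refine lintegral_congr fun ω => ?_
  rw [hittingVec_succ_apply_one, ENNReal.ofReal_add (hittingVec_nonneg _ _).1
    (hittingVec_nonneg _ _).1]

theorem tsum_lintegral_hittingVec_ne_top {ν : ProbabilityMeasure SiteLaw}
    (h : ∫⁻ ω, hittingSeries ω ∂(envLaw ν) < ⊤) :
    ∑' k, ∫⁻ ω, ENNReal.ofReal (hittingVec ω (k + 1) 0) ∂(envLaw ν) ≠ ⊤ := by
  rw [← lintegral_tsum fun k => (measurable_hittingVec_apply_zero _).ennreal_ofReal.aemeasurable]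
  exact ne_top_of_le_ne_top h.ne (lintegral_mono fun ω => le_add_self)

/-- If `1 ≤ a + 2 * b`, the recursion never takes `x` below `min (x 0) (x 1)`. -/
theorem add_two_mul_lt_one_of_tsum_ne_top {a b : ENNReal} {x y : ℕ → ENNReal}
    (hx : ∀ k, x (k + 1) = a * x k + b * y k) (hy : ∀ k, y (k + 1) = x (k + 1) + x k)
    (hx0 : x 0 ≠ 0) (hy0 : y 0 ≠ 0) (hsum : ∑' k, x (k + 1) ≠ ⊤) : a + 2 * b < 1 := by
  by_contra! hab
  have hx1 : x 1 ≠ 0 := fun h => by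
    have h' := (hx 0).symm.trans h
    simp only [add_eq_zero, mul_eq_zero, hx0, hy0, or_false] at h'
    simp [h'.1, h'.2] at hab
  set c := min (x 0) (x 1) with hc
  have hle : ∀ k, c ≤ x k ∧ c ≤ x (k + 1) := fun k => by
    induction k with
    | zero => exact ⟨min_le_left _ _, min_le_right _ _⟩
    | succ k ih =>
      refine ⟨ih.2, ?_⟩
      calc c ≤ (a + 2 * b) * c := le_mul_of_one_le_left zero_le hab
        _ = a * c + b * (c + c) := by ring
        _ ≤ a * x (k + 1) + b * (x (k + 1) + x k) := by gcongr; exacts [ih.2, ih.2, ih.1]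
        _ = x (k + 1 + 1) := by rw [hx (k + 1), hy k]
  refine hsum (top_unique ?_)
  rw [← ENNReal.tsum_const_eq_top_of_ne_zero (α := ℕ) (c := c) (by simp [hc, min_eq_iff, hx0, hx1])]
  exact ENNReal.tsum_le_tsum fun k => (hle k).2

/-- The quenched mean weight, in the sense of `popWeight`, of the offspring of an individual of
type 1 or 3. -/
noncomputable def meanWeight (w : SiteLaw) : ENNReal :=
  ENNReal.ofReal (left1 w / right1 w) + 2 * ENNReal.ofReal (left2 w / right1 w)

theorem measurable_meanWeight : Measurable meanWeight := by
  unfold meanWeight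
  fun_prop

theorem lintegral_meanWeight_lt_one {ν : ProbabilityMeasure SiteLaw}
    (h : ∫⁻ ω, hittingSeries ω ∂(envLaw ν) < ⊤) :
    ∫⁻ w, meanWeight w ∂(ν : Measure SiteLaw) < 1 := by
  have hprob : IsProbabilityMeasure (envLaw ν) := by unfold envLaw; infer_instance
  simp only [meanWeight]
  rw [lintegral_add_left (by fun_prop), lintegral_const_mul _ (by fun_prop)]
  refine add_two_mul_lt_one_of_tsum_ne_top
    (x := fun k => ∫⁻ ω, ENNReal.ofReal (hittingVec ω k 0) ∂(envLaw ν))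
    (lintegral_hittingVec_succ_apply_zero ν)
    (lintegral_hittingVec_succ_apply_one ν) ?_ ?_ (tsum_lintegral_hittingVec_ne_top h) <;>
  simp [hittingVec_zero]

/-! ### The stationary law -/

/-- The Lyapunov function of the branching chain. Type 2 counts twice because each of its
individuals has a further child of type 3. -/
def popWeight (x : Pop) : NNReal := x 0 + 2 * x 1 + x 2

theorem popWeight_zero : popWeight 0 = 0 := by simp [popWeight]

theorem popWeight_add (x y : Pop) : popWeight (x + y) = popWeight x + popWeight y := by
  simp only [popWeight, Pi.add_apply, Nat.cast_add]
  ring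

theorem finite_popWeight_le (R : NNReal) : {x | popWeight x ≤ R}.Finite := by
  refine (Set.finite_Iic (fun _ => ⌊R⌋₊ : Pop)).subset fun x hx i => Nat.le_floor ?_
  have hcoord : (x i : NNReal) ≤ popWeight x := by
    unfold popWeight
    norm_cast
    match i with
    | 0 | 1 | 2 => omega
  exact hcoord.trans hx

theorem lintegral_popWeight_offspringWith {w : SiteLaw} (hw : 0 < right1 w) (c : ℕ) :
    ∫⁻ y, popWeight y ∂(offspringWith w c) = meanWeight w + c := by
  have := isProbabilityMeasure_offspringWith hw c
  have hr0 : ENNReal.ofReal (right1 w) ≠ 0 := by simpa using hw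
  have hsplit : ∀ y : Pop, (popWeight y : ENNReal) = y 0 + 2 * y 1 + y 2 := fun y => by
    simp [popWeight]
  have hmean : ∀ p, ENNReal.ofReal (right1 w) * (p * (ENNReal.ofReal (right1 w))⁻¹ ^ 2)
      = p * (ENNReal.ofReal (right1 w))⁻¹ := fun p => by
    rw [mul_left_comm, pow_two, ← mul_assoc (ENNReal.ofReal (right1 w)),
      ENNReal.mul_inv_cancel hr0 ENNReal.ofReal_ne_top, one_mul]
  have hthird : ∫⁻ y, (y 2 : ENNReal) ∂(offspringWith w c) = c := by
    have h1 := measure_univ (μ := offspringWith w c)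
    rw [← lintegral_one, lintegral_offspringWith] at h1
    rw [lintegral_offspringWith]
    simp only [Matrix.cons_val, ENNReal.tsum_mul_left, one_mul] at h1 ⊢
    rw [mul_left_comm, h1, mul_one]
  simp only [hsplit]
  rw [lintegral_add_left .of_discrete, lintegral_add_left .of_discrete,
    lintegral_const_mul _ .of_discrete, hthird, lintegral_offspringWith, lintegral_offspringWith]
  simp only [Matrix.cons_val_zero, Matrix.cons_val_one]
  rw [tsum_fst_mul_choose_mul_pow, tsum_snd_mul_choose_mul_pow, inv_one_sub_ofReal_left, hmean,
    hmean, meanWeight, ENNReal.ofReal_div_of_pos hw, ENNReal.ofReal_div_of_pos hw]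
  rfl

theorem lintegral_popWeight_quenchedStep {w : SiteLaw} (hw : 0 < right1 w) (x : Pop) :
    ∫⁻ y, popWeight y ∂(quenchedStep w x) = parents x * meanWeight w + x 1 := by
  have : ∀ c, IsProbabilityMeasure (offspringWith w c) := isProbabilityMeasure_offspringWith hw
  have hadd : ∀ u v : Pop, (popWeight (u + v) : ENNReal) = popWeight u + popWeight v :=
    fun u v => by rw [popWeight_add, ENNReal.coe_add]
  have hpow : ∀ c n, ∫⁻ y, popWeight y ∂(convPow (offspringWith w c) n)
      = n * (meanWeight w + c) := fun c n => by
    rw [lintegral_convPow_of_add (by simp [popWeight_zero]) hadd,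
      lintegral_popWeight_offspringWith hw]
  simp only [quenchedStep, offspring]
  rw [lintegral_conv_of_add .of_discrete hadd, lintegral_conv_of_add .of_discrete hadd,
    hpow, hpow, hpow]
  simp only [Fin.isValue, zero_ne_one, if_true, if_false, Fin.reduceEq, parents, Nat.cast_add,
    Nat.cast_one, Nat.cast_zero, add_zero]
  ring

theorem lintegral_popWeight_transition {ν : ProbabilityMeasure SiteLaw}
    (hν : ∀ᵐ w ∂(ν : Measure SiteLaw), 0 < right1 w) (x : Pop) :
    ∫⁻ y, popWeight y ∂(transition ν x)
      = parents x * ∫⁻ w, meanWeight w ∂(ν : Measure SiteLaw) + x 1 := by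
  rw [lintegral_transition,
    lintegral_congr_ae (hν.mono fun w hw => lintegral_popWeight_quenchedStep hw x),
    lintegral_add_right _ measurable_const, lintegral_const_mul _ measurable_meanWeight,
    lintegral_const, measure_univ, mul_one]

/-- As `x 1` is half of the contribution of type 2 to `popWeight x`, the contraction factor is
`(1 + S) / 2`. -/
theorem parents_mul_add_le {S : NNReal} (hS : S < 1) (x : Pop) :
    parents x * S + x 1 ≤ (1 + S) / 2 * popWeight x + 1 := by
  rw [← NNReal.coe_le_coe]
  push_cast [parents, popWeight]
  have hS' : (S : ℝ) < 1 := mod_cast hS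
  have h0 := mul_nonneg (sub_nonneg.2 hS'.le) (x 0).cast_nonneg
  have h2 := mul_nonneg (sub_nonneg.2 hS'.le) (x 2).cast_nonneg
  linarith

theorem exists_invariant_transition {ν : ProbabilityMeasure SiteLaw}
    (hν : ∀ᵐ w ∂(ν : Measure SiteLaw), 0 < right1 w)
    (hball : ∫⁻ ω, hittingSeries ω ∂(envLaw ν) < ⊤) :
    ∃ π : Measure Pop, IsProbabilityMeasure π ∧ (transition ν).Invariant π ∧
      Integrable (fun y => (popWeight y : ℝ)) π := by
  have := isMarkovKernel_transition hν
  have hmean := lintegral_meanWeight_lt_one hball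
  have hstep := lintegral_popWeight_transition hν
  lift ∫⁻ w, meanWeight w ∂(ν : Measure SiteLaw) to NNReal using hmean.ne_top with S
  have hS : S < 1 := mod_cast hmean
  have hfix : (1 + S) / 2 * (2 / (1 - S)) + 1 ≤ 2 / (1 - S) := by
    have : (0 : ℝ) < 1 - S := sub_pos.2 hS
    rw [← NNReal.coe_le_coe]
    push_cast [NNReal.coe_sub hS.le]
    refine le_of_eq ?_
    field_simp
    ring
  obtain ⟨π, hπ, hinv, hle⟩ := exists_invariant_of_drift (Q := transition ν) (V := popWeight)
    (ρ := ((1 + S) / 2 : NNReal)) (b := 1) (D := (2 / (1 - S) : NNReal)) (μ := Measure.dirac 0)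
    (fun _ => continuous_of_discreteTopology) continuous_of_discreteTopology
    (fun R => (finite_popWeight_le R).isCompact)
    (fun x => by rw [hstep]; exact_mod_cast parents_mul_add_le hS x) (mod_cast hfix)
    ENNReal.coe_ne_top (by simp [popWeight_zero])
  exact ⟨π, hπ, hinv, Measurable.of_discrete.aestronglyMeasurable,
    hasFiniteIntegral_iff_ofNNReal.2 (hle.trans_lt ENNReal.coe_lt_top)⟩

/-! ### Moments determine the site law -/

theorem measure_eq_of_integral_pow_mul_pow_eq {K : Type*} [TopologicalSpace K] [PolishSpace K]
    [MeasurableSpace K] [BorelSpace K] {μ μ' : Measure K} [IsFiniteMeasure μ] [IsFiniteMeasure μ']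
    {f g : BoundedContinuousFunction K ℝ}
    (hfg : ∀ x y, f x = f y → g x = g y → x = y)
    (hmom : ∀ i j : ℕ, ∫ x, f x ^ i * g x ^ j ∂μ = ∫ x, f x ^ i * g x ^ j ∂μ') : μ = μ' := by
  let A : StarSubalgebra ℝ (BoundedContinuousFunction K ℝ) :=
    { Algebra.adjoin ℝ {f, g} with star_mem' := fun ha => ha }
  refine ext_of_forall_mem_subalgebra_integral_eq_of_polish (𝕜 := ℝ) (A := A) ?_ fun h hh => ?_
  · intro x y hxy
    by_cases hf : f x = f y
    · exact ⟨_, ⟨_, ⟨g, Algebra.subset_adjoin (by simp), rfl⟩, rfl⟩, fun hg => hxy (hfg x y hf hg)⟩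
    · exact ⟨_, ⟨_, ⟨f, Algebra.subset_adjoin (by simp), rfl⟩, rfl⟩, hf⟩
  · have hspan : h ∈ Submodule.span ℝ (Submonoid.closure {f, g} : Set _) := by
      rw [← Algebra.adjoin_eq_span]
      exact hh
    clear hh
    induction hspan using Submodule.span_induction with
    | mem h hh =>
      obtain ⟨i, j, rfl⟩ := (Submonoid.mem_closure_pair _ _ _).1 hh
      exact hmom i j
    | zero => simp
    | add h₁ h₂ _ _ ih₁ ih₂ =>
      simp only [BoundedContinuousFunction.coe_add, Pi.add_apply]
      rw [integral_add (h₁.integrable _) (h₂.integrable _),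
        integral_add (h₁.integrable _) (h₂.integrable _), ih₁, ih₂]
    | smul c h _ ih =>
      simp only [BoundedContinuousFunction.coe_smul]
      rw [integral_smul, integral_smul, ih]

theorem eq_of_withDensity_eq {α : Type*} [MeasurableSpace α] {μ μ' : Measure α} {r : α → ENNReal}
    (hr : Measurable r) (hμ : ∀ᵐ x ∂μ, r x ≠ 0) (hμ' : ∀ᵐ x ∂μ', r x ≠ 0) (htop : ∀ x, r x ≠ ⊤)
    (h : μ.withDensity r = μ'.withDensity r) : μ = μ' := by
  rw [← withDensity_inv_same hr hμ (.of_forall htop), h,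
    withDensity_inv_same hr hμ' (.of_forall htop)]

theorem siteLaw_ext {w w' : SiteLaw} (h1 : left1 w = left1 w') (h2 : left2 w = left2 w') :
    w = w' := by
  have hr : right1 w = right1 w' := by
    linarith [left1_add_left2_add_right1 w, left1_add_left2_add_right1 w']
  ext i
  fin_cases i
  exacts [h2, h1, hr]

theorem eq_of_annealedWeight_eq {ν ν' : ProbabilityMeasure SiteLaw}
    (hr : ∀ᵐ w ∂(ν : Measure SiteLaw), 0 < right1 w)
    (hr' : ∀ᵐ w ∂(ν' : Measure SiteLaw), 0 < right1 w)
    (h : ∀ i j, annealedWeight ν (0, ![i, j, 0]) = annealedWeight ν' (0, ![i, j, 0])) :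
    ν = ν' := by
  let r : SiteLaw → ENNReal := fun w => ENNReal.ofReal (right1 w)
  have hmom : ∀ (κ : ProbabilityMeasure SiteLaw) (i j : ℕ),
      ∫ w, left1 w ^ i * left2 w ^ j ∂((κ : Measure SiteLaw).withDensity r)
        = annealedWeight κ (0, ![i, j, 0]) := fun κ i j => by
    rw [integral_withDensity_eq_integral_toReal_smul (by fun_prop)
      (.of_forall fun _ => ENNReal.ofReal_lt_top)]
    refine integral_congr_ae (.of_forall fun w => ?_)
    simp [ENNReal.toReal_ofReal (right1_nonneg w), siteMonomial, parents, mul_comm]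
  have hfin : ∀ κ : ProbabilityMeasure SiteLaw,
      IsFiniteMeasure ((κ : Measure SiteLaw).withDensity r) := fun κ =>
    isFiniteMeasure_withDensity_ofReal (Integrable.of_bound (by fun_prop) 1 (.of_forall fun w =>
      (Real.norm_of_nonneg (right1_nonneg w)).trans_le (right1_le_one w))).2
  have := hfin ν
  have := hfin ν'
  refine ProbabilityMeasure.toMeasure_injective (eq_of_withDensity_eq (r := r) (by fun_prop)
    (hr.mono fun w hw => ?_) (hr'.mono fun w hw => ?_) (fun _ => ENNReal.ofReal_ne_top)
    (measure_eq_of_integral_pow_mul_pow_eq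
      (f := .mkOfCompact ⟨left1, continuous_left1⟩) (g := .mkOfCompact ⟨left2, continuous_left2⟩)
      (fun _ _ => siteLaw_ext) fun i j => ?_))
  · simpa [r] using hw
  · simpa [r] using hw
  · exact (hmom ν i j).trans ((h i j).trans (hmom ν' i j).symm)

/-! ### Jensen's inequality for the logarithm -/

section Jensen

variable {α : Type*} [MeasurableSpace α] {P : Measure α} [IsProbabilityMeasure P] {f : α → ℝ}

theorem integral_log_lt_log_integral (hpos : ∀ᵐ x ∂P, 0 < f x) (hf : Integrable f P)
    (hlog : Integrable (fun x => Real.log (f x)) P) (hne : ¬ f =ᵐ[P] fun _ => ∫ y, f y ∂P) :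
    ∫ x, Real.log (f x) ∂P < Real.log (∫ x, f x ∂P) := by
  have hexp : (Real.exp ∘ fun x => Real.log (f x)) =ᵐ[P] f := hpos.mono fun x => Real.exp_log
  have hint : ∫ x, Real.exp (Real.log (f x)) ∂P = ∫ x, f x ∂P := integral_congr_ae hexp
  have hdich := strictConvexOn_exp.ae_eq_const_or_map_average_lt (μ := P)
    Real.continuous_exp.continuousOn isClosed_univ (.of_forall fun _ => Set.mem_univ _) hlog
    (hf.congr hexp.symm)
  simp only [average_eq_integral, hint] at hdich
  refine hdich.elim (fun hconst => (hne ?_).elim) fun hlt => ?_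
  · have hfconst : f =ᵐ[P] fun _ => Real.exp (∫ y, Real.log (f y) ∂P) := by
      filter_upwards [hexp, hconst] with x hx hcx
      rw [← hx, Function.comp_apply, hcx, Function.const_apply]
    rw [integral_congr_ae hfconst]
    simpa using hfconst
  · rwa [Real.lt_log_iff_exp_lt ((Real.exp_pos _).trans hlt)]

theorem integral_log_le_log_integral (hpos : ∀ᵐ x ∂P, 0 < f x) (hf : Integrable f P)
    (hlog : Integrable (fun x => Real.log (f x)) P) :
    ∫ x, Real.log (f x) ∂P ≤ Real.log (∫ x, f x ∂P) := by
  by_cases hconst : f =ᵐ[P] fun _ => ∫ y, f y ∂P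
  · have hlogconst : (fun x => Real.log (f x)) =ᵐ[P] fun _ => Real.log (∫ y, f y ∂P) :=
      hconst.mono fun _ => congrArg Real.log
    rw [integral_congr_ae hlogconst]
    simp
  · exact (integral_log_lt_log_integral hpos hf hlog hconst).le

end Jensen

/-! ### Bounds on the log-weight -/

/-- The bound `E log ω_0(l) ≥ -C` for the three jumps `l`, with the conventions of `LogMoment`. -/
def LogMomentBound (C : ℝ) (ν : ProbabilityMeasure SiteLaw) : Prop :=
  ∀ p ∈ ({left2, left1, right1} : Set (SiteLaw → ℝ)), (∀ᵐ w ∂(ν : Measure SiteLaw), 0 < p w) ∧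
    Integrable (fun w => Real.log (p w)) (ν : Measure SiteLaw) ∧
      -C ≤ ∫ w, Real.log (p w) ∂(ν : Measure SiteLaw)

theorem exists_logMomentBound {d : ℕ} {Θ : Set (EuclideanSpace ℝ (Fin d))}
    {ν : Θ → ProbabilityMeasure SiteLaw} (h : LogMoment ν) :
    ∃ C, ∀ θ, LogMomentBound C (ν θ) := by
  choose! c hc using h
  refine ⟨|c left2| + |c left1| + |c right1|, fun θ p hp => ?_⟩
  refine ⟨(hc p hp θ).1, (hc p hp θ).2.1, le_trans ?_ (hc p hp θ).2.2⟩
  have := abs_nonneg (c left2)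
  have := abs_nonneg (c left1)
  have := abs_nonneg (c right1)
  rcases hp with rfl | rfl | rfl
  · linarith [neg_abs_le (c left2)]
  · linarith [neg_abs_le (c left1)]
  · linarith [neg_abs_le (c right1)]

section LogWeight

variable {C : ℝ} {ν : ProbabilityMeasure SiteLaw}

theorem LogMomentBound.elliptic (h : LogMomentBound C ν) : Elliptic ν := by
  filter_upwards [(h left1 (by simp)).1, (h left2 (by simp)).1, (h right1 (by simp)).1]
    with w h1 h2 hr using ⟨h1, h2, hr⟩

theorem LogMomentBound.nonneg (h : LogMomentBound C ν) : 0 ≤ C := by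
  have hle : ∫ w, Real.log (right1 w) ∂(ν : Measure SiteLaw) ≤ 0 :=
    integral_nonpos fun w => Real.log_nonpos (right1_nonneg w) (right1_le_one w)
  linarith [(h right1 (by simp)).2.2]

theorem LogMomentBound.integral_log_siteMonomial (h : LogMomentBound C ν) (i j n : ℕ) :
    Integrable (fun w => Real.log (siteMonomial i j n w)) (ν : Measure SiteLaw) ∧
      -(C * (i + j + n)) ≤ ∫ w, Real.log (siteMonomial i j n w) ∂(ν : Measure SiteLaw) := by
  obtain ⟨-, int2, le2⟩ := h left2 (by simp)
  obtain ⟨-, int1, le1⟩ := h left1 (by simp)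
  obtain ⟨-, intr, ler⟩ := h right1 (by simp)
  have hlog : (fun w => Real.log (siteMonomial i j n w)) =ᵐ[(ν : Measure SiteLaw)] fun w =>
      i * Real.log (left1 w) + j * Real.log (left2 w) + n * Real.log (right1 w) :=
    h.elliptic.mono fun w ⟨h1, h2, hr⟩ => by
      simp only [siteMonomial]
      rw [Real.log_mul (by positivity) (by positivity), Real.log_mul (by positivity)
        (by positivity), Real.log_pow, Real.log_pow, Real.log_pow]
  have int12 : Integrable (fun w => i * Real.log (left1 w) + j * Real.log (left2 w))
      (ν : Measure SiteLaw) := (int1.const_mul _).add (int2.const_mul _)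
  refine ⟨(int12.add (intr.const_mul (n : ℝ))).congr hlog.symm, ?_⟩
  rw [integral_congr_ae hlog, integral_add int12 (intr.const_mul _),
    integral_add (int1.const_mul _) (int2.const_mul _)]
  simp only [integral_const_mul]
  have := mul_le_mul_of_nonneg_left le1 i.cast_nonneg
  have := mul_le_mul_of_nonneg_left le2 j.cast_nonneg
  have := mul_le_mul_of_nonneg_left ler n.cast_nonneg
  linarith

theorem annealedWeight_le_one (ν : ProbabilityMeasure SiteLaw) (z : Pop × Pop) :
    annealedWeight ν z ≤ 1 := by
  simpa [annealedWeight] using integral_mono (integrable_siteMonomial ν _ _ _)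
    (integrable_const 1) (siteMonomial_le_one (z.2 0) (z.2 1) (parents z.1))

theorem abs_logWeight_le (h : LogMomentBound C ν) (z : Pop × Pop) :
    |logWeight ν z| ≤ C * (popWeight z.1 + popWeight z.2 + 1) := by
  have hle : (z.2 0 + z.2 1 + parents z.1 : ℝ) ≤ popWeight z.1 + popWeight z.2 + 1 := by
    simp only [parents, popWeight]
    norm_cast
    omega
  obtain ⟨hlog, hbound⟩ := h.integral_log_siteMonomial (z.2 0) (z.2 1) (parents z.1)
  have hpos : ∀ᵐ w ∂(ν : Measure SiteLaw), 0 < siteMonomial (z.2 0) (z.2 1) (parents z.1) w :=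
    h.elliptic.mono fun w ⟨h1, h2, hr⟩ => by unfold siteMonomial; positivity
  have hjensen := integral_log_le_log_integral hpos (integrable_siteMonomial ν _ _ _) hlog
  rw [logWeight_eq_log_annealedWeight, abs_of_nonpos
    (Real.log_nonpos (annealedWeight_pos h.elliptic z).le (annealedWeight_le_one ν z))]
  exact (neg_le.1 (hbound.trans hjensen)).trans (mul_le_mul_of_nonneg_left hle h.nonneg)

theorem continuous_annealedWeight (z : Pop × Pop) : Continuous fun ν => annealedWeight ν z :=
  ProbabilityMeasure.continuous_integral_boundedContinuousFunction
    (.mkOfCompact ⟨_, continuous_siteMonomial _ _ _⟩)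

theorem continuousOn_logWeight (C : ℝ) (z : Pop × Pop) :
    ContinuousOn (fun ν => logWeight ν z) {ν | LogMomentBound C ν} :=
  (continuous_annealedWeight z).continuousOn.log fun _ hν => (annealedWeight_pos hν.elliptic z).ne'

end LogWeight

/-! ### The contrast -/

section Contrast

variable {ν ν' : ProbabilityMeasure SiteLaw} {π : Measure Pop}

theorem integrable_logWeight {C : ℝ} (hν' : LogMomentBound C ν')
    (hdom : Integrable (fun z : Pop × Pop => (popWeight z.1 + popWeight z.2 + 1 : ℝ))
      (pairLaw ν π)) : Integrable (logWeight ν') (pairLaw ν π) :=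
  (hdom.const_mul C).mono' Measurable.of_discrete.aestronglyMeasurable
    (.of_forall (abs_logWeight_le hν'))

theorem continuousOn_contrast (C : ℝ)
    (hdom : Integrable (fun z : Pop × Pop => (popWeight z.1 + popWeight z.2 + 1 : ℝ))
      (pairLaw ν π)) : ContinuousOn (contrast ν π) {ν' | LogMomentBound C ν'} :=
  continuousOn_of_dominated (fun _ _ => Measurable.of_discrete.aestronglyMeasurable)
    (fun _ hν' => .of_forall (abs_logWeight_le hν')) (hdom.const_mul C)
    (.of_forall (continuousOn_logWeight C))

variable [IsProbabilityMeasure π]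

theorem integrable_popWeight_pairLaw (hr : ∀ᵐ w ∂(ν : Measure SiteLaw), 0 < right1 w)
    (hinv : (transition ν).Invariant π) (hπ : Integrable (fun y => (popWeight y : ℝ)) π) :
    Integrable (fun z : Pop × Pop => (popWeight z.1 + popWeight z.2 + 1 : ℝ)) (pairLaw ν π) := by
  have := isMarkovKernel_transition hr
  have hprob : IsProbabilityMeasure (pairLaw ν π) := by unfold pairLaw; infer_instance
  have hfst : MeasurePreserving Prod.fst (pairLaw ν π) π :=
    ⟨measurable_fst, Measure.fst_compProd π (transition ν)⟩
  have hsnd : MeasurePreserving Prod.snd (pairLaw ν π) π :=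
    ⟨measurable_snd, (Measure.snd_compProd π (transition ν)).trans hinv.def⟩
  exact ((hfst.integrable_comp_of_integrable hπ).add
    (hsnd.integrable_comp_of_integrable hπ)).add (integrable_const 1)

theorem pairLaw_singleton_ne_zero (hν : Elliptic ν) (hinv : (transition ν).Invariant π)
    (i j : ℕ) : pairLaw ν π {(0, ![i, j, 0])} ≠ 0 := by
  have hr := hν.mono fun _ hw => hw.2.2
  have := isMarkovKernel_transition hr
  rw [pairLaw, ← Set.singleton_prod_singleton, Measure.compProd_apply_prod
    (measurableSet_singleton _) (measurableSet_singleton _), lintegral_singleton]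
  refine mul_ne_zero ?_ fun h0 => IsProbabilityMeasure.ne_zero π
    (eq_zero_of_invariant_of_singleton_eq_zero (isAccessible_zero hr) hinv h0)
  rw [transition_eq_withDensity, withDensity_apply _ (measurableSet_singleton _),
    lintegral_singleton, stepCoeff_zero]
  exact mul_ne_zero (ENNReal.ofReal_pos.2 (annealedWeight_pos hν _)).ne'
    (offspringCoeff_singleton_ne_zero i j 0)

theorem lintegral_annealedWeight_div (hν : Elliptic ν)
    (hr' : ∀ᵐ w ∂(ν' : Measure SiteLaw), 0 < right1 w) :
    ∫⁻ z, ENNReal.ofReal (annealedWeight ν' z / annealedWeight ν z) ∂(pairLaw ν π) = 1 := by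
  have := isMarkovKernel_transition (hν.mono fun _ hw => hw.2.2)
  have := isMarkovKernel_transition hr'
  have hratio : ∀ x, ∫⁻ y, ENNReal.ofReal (annealedWeight ν' (x, y) / annealedWeight ν (x, y))
      ∂(transition ν x) = 1 := fun x => by
    have hpos := annealedWeight_pos hν
    rw [transition_eq_withDensity, lintegral_withDensity_eq_lintegral_mul _ .of_discrete
      .of_discrete, ← measure_univ (μ := transition ν' x), transition_eq_withDensity,
      withDensity_apply _ .univ, setLIntegral_univ]
    refine lintegral_congr fun y => ?_
    rw [Pi.mul_apply, ← ENNReal.ofReal_mul (hpos _).le, mul_div_cancel₀ _ (hpos _).ne']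
  rw [pairLaw, Measure.lintegral_compProd .of_discrete]
  simp [hratio]

theorem integrable_annealedWeight_div (hν : Elliptic ν) (hν' : Elliptic ν') :
    Integrable (fun z => annealedWeight ν' z / annealedWeight ν z) (pairLaw ν π) := by
  refine ⟨Measurable.of_discrete.aestronglyMeasurable, ?_⟩
  rw [hasFiniteIntegral_iff_ofReal (.of_forall fun z =>
    (div_pos (annealedWeight_pos hν' z) (annealedWeight_pos hν z)).le),
    lintegral_annealedWeight_div hν (hν'.mono fun _ hw => hw.2.2)]
  exact ENNReal.one_lt_top

theorem integral_annealedWeight_div (hν : Elliptic ν) (hν' : Elliptic ν') :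
    ∫ z, annealedWeight ν' z / annealedWeight ν z ∂(pairLaw ν π) = 1 := by
  rw [integral_eq_lintegral_of_nonneg_ae (.of_forall fun z =>
      (div_pos (annealedWeight_pos hν' z) (annealedWeight_pos hν z)).le)
    (integrable_annealedWeight_div hν hν').1,
    lintegral_annealedWeight_div hν (hν'.mono fun _ hw => hw.2.2), ENNReal.toReal_one]

theorem eq_of_annealedWeight_div_ae_eq_one (hν : Elliptic ν) (hν' : Elliptic ν')
    (hinv : (transition ν).Invariant π)
    (h : (fun z => annealedWeight ν' z / annealedWeight ν z) =ᵐ[pairLaw ν π] fun _ => 1) :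
    ν' = ν :=
  eq_of_annealedWeight_eq (hν'.mono fun _ hw => hw.2.2) (hν.mono fun _ hw => hw.2.2) fun i j =>
    (div_eq_one_iff_eq (annealedWeight_pos hν _).ne').1
      (ae_iff_of_countable.1 h _ (pairLaw_singleton_ne_zero hν hinv i j))

theorem contrast_lt_contrast (hν : Elliptic ν) (hν' : Elliptic ν')
    (hinv : (transition ν).Invariant π) (hi : Integrable (logWeight ν) (pairLaw ν π))
    (hi' : Integrable (logWeight ν') (pairLaw ν π)) (hne : ν' ≠ ν) :
    contrast ν π ν' < contrast ν π ν := by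
  have := isMarkovKernel_transition (hν.mono fun _ hw => hw.2.2)
  have hprob : IsProbabilityMeasure (pairLaw ν π) := by unfold pairLaw; infer_instance
  have hpos := annealedWeight_pos hν
  have hpos' := annealedWeight_pos hν'
  have hlog : (fun z => Real.log (annealedWeight ν' z / annealedWeight ν z)) =
      fun z => logWeight ν' z - logWeight ν z :=
    funext fun z => Real.log_div (hpos' z).ne' (hpos z).ne'
  have hgibbs := integral_log_lt_log_integral (P := pairLaw ν π)
    (.of_forall fun z => div_pos (hpos' z) (hpos z)) (integrable_annealedWeight_div hν hν')
    (by rw [hlog]; exact hi'.sub hi) fun hconst =>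
      hne (eq_of_annealedWeight_div_ae_eq_one hν hν' hinv (by
        rwa [integral_annealedWeight_div hν hν'] at hconst))
  rw [hlog, integral_sub hi' hi, integral_annealedWeight_div hν hν', Real.log_one] at hgibbs
  exact sub_neg.1 hgibbs

end Contrast

theorem iSup_notMem_lt_of_upperSemicontinuous {X : Type*} [TopologicalSpace X] [CompactSpace X]
    {l : X → ℝ} (hl : UpperSemicontinuous l) {x₀ : X} (hmax : ∀ x ≠ x₀, l x < l x₀)
    {U : Set X} (hU : U ∈ 𝓝 x₀) : (⨆ x, ⨆ _ : x ∉ U, (l x : EReal)) < l x₀ := by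
  have hsub : ∀ x, x ∉ U → x ∈ (interior U)ᶜ := fun _ hx h => hx (interior_subset h)
  rcases (interior U)ᶜ.eq_empty_or_nonempty with hempty | hnonempty
  · refine lt_of_le_of_lt (iSup₂_le fun x hx => ?_) (EReal.bot_lt_coe _)
    exact (Set.eq_empty_iff_forall_notMem.1 hempty x (hsub x hx)).elim
  · obtain ⟨x₁, hx₁, hx₁max⟩ := (hl.upperSemicontinuousOn _).exists_isMaxOn hnonempty
      isOpen_interior.isClosed_compl.isCompact
    refine lt_of_le_of_lt (iSup₂_le fun x hx => EReal.coe_le_coe_iff.2 (hx₁max (hsub x hx)))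
      (EReal.coe_lt_coe_iff.2 (hmax x₁ ?_))
    rintro rfl
    exact hx₁ (mem_interior_iff_mem_nhds.2 hU)

end RWRE

theorem mainTheorem6_general {X : Type*} [TopologicalSpace X] [CompactSpace X]
    {ν : X → ProbabilityMeasure RWRE.SiteLaw} (hν : Continuous ν) {θstar : X} {C : ℝ}
    (hlog : ∀ θ, RWRE.LogMomentBound C (ν θ))
    (hball : ∫⁻ ω, RWRE.hittingSeries ω ∂(RWRE.envLaw (ν θstar)) < ⊤)
    (hid : ∀ θ ≠ θstar, ν θ ≠ ν θstar) :
    ∃ π : Measure RWRE.Pop,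
      (IsProbabilityMeasure π ∧ (RWRE.transition (ν θstar)).Invariant π ∧
        ∀ π' : Measure RWRE.Pop, IsProbabilityMeasure π' →
          (RWRE.transition (ν θstar)).Invariant π' → π' = π) ∧
      (∀ θ, Integrable (RWRE.logWeight (ν θ)) (RWRE.pairLaw (ν θstar) π)) ∧
      (∀ U ∈ 𝓝 θstar, (⨆ θ, ⨆ _ : θ ∉ U, (RWRE.contrast (ν θstar) π (ν θ) : EReal))
        < RWRE.contrast (ν θstar) π (ν θstar)) ∧
      (∀ θ ≠ θstar, RWRE.contrast (ν θstar) π (ν θ) < RWRE.contrast (ν θstar) π (ν θstar)) := by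
  have hell := fun θ => (hlog θ).elliptic
  have hright := (hell θstar).mono fun _ hw => hw.2.2
  have := RWRE.isMarkovKernel_transition hright
  obtain ⟨π, hπ, hinv, hmean⟩ := RWRE.exists_invariant_transition hright hball
  have hdom := RWRE.integrable_popWeight_pairLaw hright hinv hmean
  have hint := fun θ => RWRE.integrable_logWeight (hlog θ) hdom
  have hcont : Continuous fun θ => RWRE.contrast (ν θstar) π (ν θ) :=
    (RWRE.continuousOn_contrast C hdom).comp_continuous hν hlog
  have hlt : ∀ θ ≠ θstar, RWRE.contrast (ν θstar) π (ν θ) < RWRE.contrast (ν θstar) π (ν θstar) :=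
    fun θ hθ => RWRE.contrast_lt_contrast (hell θstar) (hell θ) hinv (hint θstar) (hint θ)
      (hid θ hθ)
  exact ⟨π, ⟨hπ, hinv, fun π' _ hinv' =>
      RWRE.invariant_unique (RWRE.isAccessible_zero hright) hinv' hinv⟩, hint,
    fun U hU => RWRE.iSup_notMem_lt_of_upperSemicontinuous hcont.upperSemicontinuous hlt hU, hlt⟩

theorem mainTheorem6 {d : ℕ} (hd : 1 ≤ d) (Θ : Set (EuclideanSpace ℝ (Fin d)))
    (hΘ : IsCompact Θ) (ν : Θ → ProbabilityMeasure RWRE.SiteLaw)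
    (θstar : Θ) (hstar : (θstar : EuclideanSpace ℝ (Fin d)) ∈ interior Θ)
    (h1 : RWRE.LogMoment ν) (h2 : RWRE.NegativeLyapunov ν) (h3 : RWRE.Ballistic ν)
    (h4 : Continuous ν) (h5 : RWRE.Identifiable ν) :
    ∃ π : Measure RWRE.Pop,
      -- `π` is the unique invariant probability measure of the chain under the true parameter
      (IsProbabilityMeasure π ∧ (RWRE.transition (ν θstar)).Invariant π ∧
        ∀ π' : Measure RWRE.Pop, IsProbabilityMeasure π' →
          (RWRE.transition (ν θstar)).Invariant π' → π' = π) ∧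
      -- the contrast is a well-defined finite expectation
      (∀ θ : Θ, Integrable (RWRE.logWeight (ν θ)) (RWRE.pairLaw (ν θstar) π)) ∧
      (∀ ε : ℝ, 0 < ε →
        (⨆ θ : Θ, ⨆ _ : ε ≤ ‖(θ : EuclideanSpace ℝ (Fin d)) - θstar‖,
            (RWRE.contrast (ν θstar) π (ν θ) : EReal))
          < (RWRE.contrast (ν θstar) π (ν θstar) : EReal)) ∧
      (∀ θ : Θ, θ ≠ θstar →
        RWRE.contrast (ν θstar) π (ν θ) < RWRE.contrast (ν θstar) π (ν θstar)) := by
  have : CompactSpace Θ := isCompact_iff_compactSpace.1 hΘ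
  obtain ⟨C, hC⟩ := RWRE.exists_logMomentBound h1
  obtain ⟨π, hπ, hint, hsep, hlt⟩ :=
    mainTheorem6_general h4 hC (h3 θstar) fun θ => (h5 θ θstar).2
  refine ⟨π, hπ, hint, fun ε hε => ?_, hlt⟩
  simpa [dist_eq_norm, Subtype.dist_eq] using hsep _ (Metric.ball_mem_nhds θstar hε)
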